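/- **The code.** Let $L\ge 0$ and $\Sigma=\{0,1,2\}=\mathbb Z/3$ (directions of the three corners of a triangle, clockwise). The $N=3^L$ boundary qudits ($\mathbb C^4$ with basis $|0\rangle,\dots,|3\rangle$) are the sites $s\in\Sigma^L$ of the Sierpiński lattice; the $K=(3^L-1)/2$ bulk qudits (also $\mathbb C^4$) are the holes $x\in\bigcup_{k<L}\Sigma^k$. The block of $x\in\Sigma^k$ is the set of sites with prefix $x$; it has three sub-blocks $xc$, $c\in\Sigma$. Let $S^\sigma|\alpha\rangle=|\alpha\oplus\sigma\rangle$ (bitwise exclusive or of two-bit numbers). For each hole $x\in\Sigma^k$ and $c\in\Sigma$ put $i=x\,c\,(c+1)^{L-k-1}$, $i'=x\,(c+1)\,c^{L-k-1}$ and let $T_{ii'}=S^2_iS^3_{i'}$ if $k=L-1$, and $T_{ii'}=S^1_iS^1_{i'}$ otherwise. Let $\{|\psi_m\rangle\}$ be the product states obtained from $|0\cdots0\rangle$ by finitely many of these gates. Draw the qudit at $s$ as a triangle whose angle $1$ points in the direction $e$, the last letter of $s$, and whose angles $2,3$ point in the directions $e+1,e+2$. In $|0\rangle$ all its sides are light;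 in $|a\rangle$, $a\neq0$, the side opposite to angle $a$ is light and the other two are dark. The lateral $c$ of the loop around $x$ consists of the sites $x\,c\,w$ such that $c$ does not occur in $w$, each with its side opposite to the direction $c$. A product state shows $\beta_x=0$ at $x$ if all three laterals have an even number of dark sides, and $\beta_x=b\in\{1,2,3\}$ if exactly the two laterals $c\ne b-1$ have an odd number. Let $R:\mathcal E=(\mathbb C^4)^{\otimes K}\to\mathcal H=(\mathbb C^4)^{\otimes N}$ map $|\beta_1\cdots\beta_K\rangle$ to $2^{-K/2}$ times the sum of all $|\psi_m\rangle$ that show $\beta_x$ at every hole $x$, and let $P=RR^+$ be the projection onto the code space $\mathcal H_{\rm code}$. For a set $A$ of boundary qudits let $$\mathcal M_A=\{P\,O_A\,P : O_A \text{ is supported on } A,\ [O_A,P]=0\},$$ the algebra of logical operators that can be reconstructed on $A$. Here operators on $\mathcal H_{\rm code}$ are identified with operators $X=PXP$ on $\mathcal H$; commutants $\mathcal M'$ of sets of logical operators are taken among these, those of sets of bulk operators among all operators on $\mathcal E$, and $\mathrm Z(\mathcal M)=\mathcal M\cap\mathcal M'$. **Theorem (genuine OAQEC for arbitrary $A\overline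 A$).** For every $L$ and every bipartition of the boundary qudits into two nonempty sets $A$ and $\overline A$, connected or not, the center of $\mathcal M_A$ is nontrivial: $$\mathrm Z(\mathcal M_A)=\mathcal M_A\cap\mathcal M_{\overline A}\neq\mathbb C\,\mathbb 1_{\mathcal H_{\rm code}},$$ and, equivalently, $\mathrm Z(R^+\mathcal M_AR)\neq\mathbb C\,\mathbb 1_{\mathcal E}$. Moreover, there is a hole $x$ whose block meets both $A$ and $\overline A$, while every smaller block lies in $A$ or in $\overline A$, and there is an enumeration $\beta,\beta',\beta'',\beta'''$ of $\{0,1,2,3\}$ such that both $R(\cdots\otimes(|\beta\rangle\langle\beta|+|\beta'\rangle\langle\beta'|)_x\otimes\cdots)R^+$ and $R(\cdots\otimes(|\beta''\rangle\langle\beta''|+|\beta'''\rangle\langle\beta'''|)_x\otimes\cdots)R^+$ belong to $\mathcal M_A\cap\mathcal M_{\overline A}$. -/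

import Mathlib

namespace SierpinskiCode

open Matrix
open scoped Kronecker

/-! ### The Sierpinski lattice

The three directions (outer corners of a triangle) are `0, 1, 2 : Fin 3`, in clockwise order. -/

/-- The `3 ^ L` boundary (physical) qudits of the Sierpinski lattice with `L` levels. A site is
addressed by the directions of the nested triangular blocks that contain it, the largest first. -/
abbrev Site (L : ℕ) : Type := Fin L → Fin 3

/-- The `(3 ^ L - 1) / 2` holes, which index the bulk (logical) qudits. There is one hole for each
triangular block with more than one site; the block is addressed by a word of length `k < L`. -/
abbrev Hole (L : ℕ) : Type := Σ k : Fin L, (Fin k → Fin 3)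

/-- Labels of the boundary product basis `|α₁ ⋯ α_N⟩`. -/
abbrev Config (L : ℕ) : Type := Site L → Fin 4

/-- Labels of the bulk product basis `|β₁ ⋯ β_K⟩`. -/
abbrev BulkConfig (L : ℕ) : Type := Hole L → Fin 4

variable {L : ℕ}

/-- The triangular block around the hole `x`. -/
def block (x : Hole L) : Finset (Site L) :=
  Finset.univ.filter fun s => ∀ j : Fin x.1, s (Fin.castLE x.1.2.le j) = x.2 j

/-- The lateral of the loop around the hole `x` that lies in the sub-block of `x` in direction `c`:
the sites on the side of this sub-block that is opposite to its corner `c` and faces the hole. -/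
def lateral (x : Hole L) (c : Fin 3) : Finset (Site L) :=
  (block x).filter fun s => s x.1 = c ∧ ∀ j, x.1 < j → s j ≠ c

/-- In the sub-block of `x` in direction `c`, the corner site in direction `d`. -/
def cornerSite (x : Hole L) (c d : Fin 3) : Site L := fun j =>
  if h : j < x.1 then x.2 ⟨j, h⟩ else if j = x.1 then c else d

/-! ### Two-qudit gates and the product states `|ψ_m⟩`

On basis labels in `{0, 1, 2, 3}` the operator `S^σ` acts by `S^σ |α⟩ = |α ^^^ σ⟩` with the bitwise
exclusive or: `S^1` exchanges `0, 1` and `2, 3`; `S^2` exchanges `0, 2` and `1, 3`; `S^3` exchanges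
`0, 3` and `1, 2`. -/

/-- The action on product states of the gate `T_{ii'}` on the corner of the loop around `x` where
the sub-blocks `c` and `c + 1` touch (clockwise from `i` to `i'`). It is `S^2_i S^3_{i'}` if `i, i'`
lie in a common smallest triangular three-qudit block, and `S^1_i S^1_{i'}` otherwise. -/
def gate (x : Hole L) (c : Fin 3) (α : Config L) : Config L := fun s =>
  if s = cornerSite x c (c + 1) then α s ^^^ (if (x.1 : ℕ) + 1 = L then 2 else 1)
  else if s = cornerSite x (c + 1) c then α s ^^^ (if (x.1 : ℕ) + 1 = L then 3 else 1)
  else α s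

/-- The states `|ψ_m⟩`: all product states reached from `|0 ⋯ 0⟩` by finitely many gates. -/
inductive IsPsi : Config L → Prop
  | zero : IsPsi 0
  | step (x : Hole L) (c : Fin 3) (α : Config L) : IsPsi α → IsPsi (gate x c α)

/-! ### Entanglement patterns -/

/-- The direction in which the angle `a = 1, 2, 3` of the triangle at the site `s` points: angle `1`
points outward from the smallest three-qudit block, `2` and `3` follow clockwise. (For `a = 0` and
for `L = 0` the value is irrelevant.) -/
def angleDir (s : Site L) (a : Fin 4) : Fin 3 :=
  if h : 0 < L then s ⟨L - 1, Nat.sub_lt h Nat.one_pos⟩ + ![0, 0, 1, 2] a else 0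

/-- In the picture of the state `|a⟩` of the site `s`, the side opposite to the direction `d` is
dark. For `a = 0` all sides are light; otherwise only the side opposite to the angle `a` is light. -/
def DarkSide (s : Site L) (a : Fin 4) (d : Fin 3) : Prop :=
  a ≠ 0 ∧ angleDir s a ≠ d

instance (s : Site L) (a : Fin 4) (d : Fin 3) : Decidable (DarkSide s a d) :=
  inferInstanceAs (Decidable (_ ∧ _))

/-- Number of dark sides facing the hole `x` on its lateral in the sub-block `c`. -/
def darkCount (α : Config L) (x : Hole L) (c : Fin 3) : ℕ :=
  ((lateral x c).filter fun s => DarkSide s (α s) c).card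

/-- The loop around `x` shows the emergent degree of freedom `b`: for `b = 0` the three laterals all
have an even number of dark sides, and for `b = 1, 2, 3` exactly the two laterals outside the
sub-block in direction `b - 1` have an odd number. -/
def Shows (α : Config L) (x : Hole L) (b : Fin 4) : Prop :=
  ∀ c : Fin 3, Odd (darkCount α x c) ↔ (b ≠ 0 ∧ b ≠ c.succ)

/-! ### The encoding and the code space

Operators are matrices in the product bases; the adjoint is the conjugate transpose. -/

/-- Operators on the boundary Hilbert space `(ℂ⁴)^{⊗ N}`. -/
abbrev Op (L : ℕ) : Type := Matrix (Config L) (Config L) ℂ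

/-- Operators on the bulk Hilbert space `(ℂ⁴)^{⊗ K}`. -/
abbrev BulkOp (L : ℕ) : Type := Matrix (BulkConfig L) (BulkConfig L) ℂ

open Classical in
/-- The encoding `R`: it maps `|β₁ ⋯ β_K⟩` to `2^{-K/2}` times the sum of all `|ψ_m⟩` that show the
pattern `β`. -/
noncomputable def encoding (L : ℕ) : Matrix (Config L) (BulkConfig L) ℂ := fun α β =>
  if IsPsi α ∧ ∀ x, Shows α x (β x) then
    ((1 / Real.sqrt (2 ^ Fintype.card (Hole L)) : ℝ) : ℂ) else 0

/-- The projection `P_code = R R⁺` onto the code subspace. -/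
noncomputable def codeProj (L : ℕ) : Op L := encoding L * (encoding L)ᴴ

/-- `O` is of the form `O_A ⊗ 1` with respect to `H = H_A ⊗ H_Ā`. -/
def SupportedOn (A : Finset (Site L)) (O : Op L) : Prop :=
  ∃ M : Matrix ({s // s ∈ A} → Fin 4) ({s // s ∈ A} → Fin 4) ℂ,
    O = (M ⊗ₖ (1 : Matrix ({s // s ∉ A} → Fin 4) ({s // s ∉ A} → Fin 4) ℂ)).submatrix
      (Equiv.piEquivPiSubtypeProd (fun s => s ∈ A) fun _ => Fin 4)
      (Equiv.piEquivPiSubtypeProd (fun s => s ∈ A) fun _ => Fin 4)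

/-- The algebra `M_A` of the logical operators that can be reconstructed on `A`. Operators on the
code space are identified with the operators `X = P_code X P_code` on the boundary space. -/
def recon (A : Finset (Site L)) : Set (Op L) :=
  {X | ∃ O : Op L, SupportedOn A O ∧ O * codeProj L = codeProj L * O ∧
    X = codeProj L * O * codeProj L}

/-- The commutant, within the operators on the code space, of a set of logical operators. -/
def codeCommutant (M : Set (Op L)) : Set (Op L) :=
  {X | codeProj L * X * codeProj L = X ∧ ∀ Y ∈ M, X * Y = Y * X}

/-- The center `Z(M) = M ∩ M'` of an algebra of logical operators. -/
def codeCenter (M : Set (Op L)) : Set (Op L) := M ∩ codeCommutant M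

/-- The algebra `R⁺ M_A R` on the bulk Hilbert space. -/
def bulkRecon (A : Finset (Site L)) : Set (BulkOp L) :=
  (fun X => (encoding L)ᴴ * X * encoding L) '' recon A

/-- The center `Z(M) = M ∩ M'` of an algebra of bulk operators. -/
def bulkCenter (M : Set (BulkOp L)) : Set (BulkOp L) := M ∩ M.centralizer

/-- The bulk operator that acts as `B` on the bulk qudit `x` and trivially on all others. -/
def bulkLocal (x : Hole L) (B : Matrix (Fin 4) (Fin 4) ℂ) : BulkOp L := fun f g =>
  if ∀ y, y ≠ x → f y = g y then B (f x) (g x) else 0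

/-- The logical operator `R (⋯ ⊗ (|b⟩⟨b| + |b'⟩⟨b'|)_x ⊗ ⋯) R⁺`. -/
noncomputable def pairProj (x : Hole L) (b b' : Fin 4) : Op L :=
  encoding L * bulkLocal x (Matrix.single b b 1 + Matrix.single b' b' 1) * (encoding L)ᴴ

/-- The bipartition `A | Aᶜ` splits the block around `x`. -/
def Splits (A : Finset (Site L)) (x : Hole L) : Prop :=
  (block x ∩ A).Nonempty ∧ (block x ∩ Aᶜ).Nonempty

end SierpinskiCode

open SierpinskiCode

/-!
The code is a CSS code. After each label `0, 1, 2, 3` is written as two bits, the bitwise exclusive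
or is addition of bit vectors, and the states `|ψ_m⟩` form the span `psiSpace` of the gates. Each
side of a qudit is dark according to a linear functional of its bits, so the parities of the
laterals form a linear map `parity`, and the states `|ψ_m⟩` that show `0` everywhere form a subspace
`stabSpace` of `psiSpace`. The basis states of the code are normalized sums over the cosets of
`stabSpace` in `psiSpace`.

*The encoding is an isometry* (`encoding_isometry`). The gate at a corner of a loop changes the
parities of exactly the two laterals of this loop that meet there and no other parity
(`parity_gateVec`), so each pattern is shown, and a relation between gates involves only the
products of all three gates around a hole. These products are independent (`loops_independent`).
Hence each pattern is shown by exactly `2 ^ K` states (`card_shows`).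

*The center* (`codeCenter_recon`). The code projection absorbs the shifts in `stabSpace` and the
phases orthogonal to `psiSpace`. Shifts in `psiSpace` and phases orthogonal to `stabSpace` commute
with it, and all other products of a shift and a phase vanish on the code space. Operators on `A`
are linear combinations of products of shifts and phases on `A` (`SupportedOn.mem_span`). Averaging
an operator of the center over the logical shifts and phases on `A` leaves only those products that
commute with all of them. Linear duality (`exists_add_mem_vectorsOn_compl`) shows that such a
product can be moved to the complement of `A` by multiplication with a stabilizer
(`mem_recon_compl_of_commute`). The converse inclusion holds because operators with disjoint
supports commute.

*Nontriviality* (`exists_pairProj_mem_recon_inter`). In a split block of maximal depth each of the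
three sub-blocks lies on one side, so one of them is separated from the other two. The parity of its
lateral can be measured on its side; since the number of odd laterals is even, it is also the total
parity of the other two laterals, which can be measured on the other side. This parity tells two of
the four labels of the bulk qudit from the other two.
-/

namespace SierpinskiCode

open Matrix

variable {L : ℕ}

/-! ### Product states as bit vectors -/

/-- Bit vectors with two bits for each site. -/
abbrev BitVec2 (L : ℕ) : Type := Site L × Fin 2 → ZMod 2

/-- The binary digits of a label `0, 1, 2, 3`, the least significant digit first. -/
def digits : Fin 4 ≃ (Fin 2 → ZMod 2) where
  toFun a := ![![0, 0], ![1, 0], ![0, 1], ![1, 1]] a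
  invFun v := if v 1 = 0 then (if v 0 = 0 then 0 else 1) else (if v 0 = 0 then 2 else 3)
  left_inv := by decide
  right_inv := by decide

lemma digits_xor (a b : Fin 4) : digits (a ^^^ b) = digits a + digits b := by
  revert a b; decide

/-- The identification of product states with bit vectors. It turns the bitwise exclusive or
into addition. -/
def bits : Config L ≃ BitVec2 L where
  toFun α := fun i => digits (α i.1) i.2
  invFun v := fun s => digits.symm fun j => v (s, j)
  left_inv α := by
    funext s
    exact digits.symm_apply_apply (α s)
  right_inv v := by
    funext ⟨s, j⟩
    simp

lemma bits_apply (α : Config L) (s : Site L) (j : Fin 2) : bits α (s, j) = digits (α s) j := rfl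

lemma bits_eq_at_iff (α γ : Config L) (s : Site L) :
    (∀ j, bits α (s, j) = bits γ (s, j)) ↔ α s = γ s := by
  simp only [bits_apply]
  rw [← funext_iff, digits.injective.eq_iff]

lemma bits_zero : bits (0 : Config L) = 0 := by
  funext ⟨s, j⟩
  change digits 0 j = 0
  revert j; decide

lemma bits_xor (α γ : Config L) : bits (fun s => α s ^^^ γ s) = bits α + bits γ := by
  funext ⟨s, j⟩
  simp [bits_apply, digits_xor]

/-- The product state obtained from `α` by adding the bit vector `a`. -/
def translate (a : BitVec2 L) (α : Config L) : Config L := bits.symm (bits α + a)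

@[simp] lemma bits_translate (a : BitVec2 L) (α : Config L) :
    bits (translate a α) = bits α + a := by
  simp [translate]

lemma eq_translate_iff (a : BitVec2 L) (α γ : Config L) :
    γ = translate a α ↔ bits γ = bits α + a := by
  rw [← bits.injective.eq_iff, bits_translate]

@[simp] lemma translate_translate (a : BitVec2 L) (α : Config L) :
    translate a (translate a α) = α := by
  apply bits.injective
  simp [add_assoc, ZModModule.add_self]

/-- `translate a` as a permutation of the product states. -/
def translatePerm (a : BitVec2 L) : Equiv.Perm (Config L) :=
  ⟨translate a, translate a, translate_translate a, translate_translate a⟩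

/-! ### Shifts and phases -/

/-- The nontrivial character of `ZMod 2`. -/
def sign (t : ZMod 2) : ℂ := if t = 0 then 1 else -1

@[simp] lemma sign_zero : sign 0 = 1 := if_pos rfl

lemma sign_of_ne {t : ZMod 2} (h : t ≠ 0) : sign t = -1 := if_neg h

lemma sign_add (s t : ZMod 2) : sign (s + t) = sign s * sign t := by
  have h (u : ZMod 2) : u = 0 ∨ u = 1 := by revert u; decide
  rcases h s with rfl | rfl <;> rcases h t with rfl | rfl <;>
    simp [sign, CharTwo.add_self_eq_zero]

@[simp] lemma sign_mul_self (t : ZMod 2) : sign t * sign t = 1 := by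
  unfold sign; split_ifs <;> simp

/-- The operator that adds the bit vector `a` to the label of each product state. -/
def shift (a : BitVec2 L) : Op L := Matrix.of fun α γ => if γ = translate a α then 1 else 0

/-- The diagonal operator of signs `(-1) ^ (b · α)`. -/
def phase (b : BitVec2 L) : Op L := diagonal fun α => sign (b ⬝ᵥ bits α)

lemma shift_apply (a : BitVec2 L) (α γ : Config L) :
    shift a α γ = if γ = translate a α then 1 else 0 := rfl

@[simp] lemma shift_mul_apply (a : BitVec2 L) (M : Op L) (α γ : Config L) :
    (shift a * M) α γ = M (translate a α) γ := by
  simp [mul_apply, shift_apply]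

@[simp] lemma mul_shift_apply (a : BitVec2 L) (M : Op L) (α γ : Config L) :
    (M * shift a) α γ = M α (translate a γ) := by
  have h (δ : Config L) : (γ = translate a δ) = (δ = translate a γ) := by
    apply propext
    constructor <;> rintro rfl <;> simp
  simp [mul_apply, shift_apply, h]

@[simp] lemma phase_mul_apply (b : BitVec2 L) (M : Op L) (α γ : Config L) :
    (phase b * M) α γ = sign (b ⬝ᵥ bits α) * M α γ := by
  simp [phase, diagonal_mul]

@[simp] lemma mul_phase_apply (b : BitVec2 L) (M : Op L) (α γ : Config L) :
    (M * phase b) α γ = M α γ * sign (b ⬝ᵥ bits γ) := by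
  simp [phase, mul_diagonal]

lemma shift_mul_self (a : BitVec2 L) : shift a * shift a = 1 := by
  ext α γ
  rw [shift_mul_apply, shift_apply, translate_translate, Matrix.one_apply]
  simp only [eq_comm]

lemma phase_mul_self (b : BitVec2 L) : phase b * phase b = 1 := by
  simp [phase, diagonal_mul_diagonal]

lemma shift_add (a a' : BitVec2 L) : shift (a + a') = shift a * shift a' := by
  ext α γ
  rw [shift_mul_apply, shift_apply, shift_apply]
  simp only [eq_translate_iff, bits_translate, add_assoc]

lemma phase_add (b b' : BitVec2 L) : phase (b + b') = phase b * phase b' := by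
  simp [phase, diagonal_mul_diagonal, sign_add, add_dotProduct]

lemma phase_mul_shift (a b : BitVec2 L) :
    phase b * shift a = sign (b ⬝ᵥ a) • (shift a * phase b) := by
  ext α γ
  simp only [phase_mul_apply, Matrix.smul_apply, mul_phase_apply, smul_eq_mul, shift_apply]
  split_ifs with h
  · subst h
    simp only [bits_translate, dotProduct_add, sign_add, mul_one, one_mul]
    rw [mul_left_comm, sign_mul_self, mul_one]
  · simp

lemma shift_mul_phase (a b : BitVec2 L) :
    shift a * phase b = sign (b ⬝ᵥ a) • (phase b * shift a) := by
  rw [phase_mul_shift, smul_smul, sign_mul_self, one_smul]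

/-! ### Operators supported on a set of qudits -/

/-- The bit vectors that vanish outside the sites in `A`. -/
def vectorsOn (A : Finset (Site L)) : Submodule (ZMod 2) (BitVec2 L) where
  carrier := {v | ∀ s ∉ A, ∀ j, v (s, j) = 0}
  add_mem' ha hb s hs j := by simp [ha s hs j, hb s hs j]
  zero_mem' _ _ _ := rfl
  smul_mem' c _ ha s hs j := by simp [ha s hs j]

lemma mem_vectorsOn {A : Finset (Site L)} {v : BitVec2 L} :
    v ∈ vectorsOn A ↔ ∀ s ∉ A, ∀ j, v (s, j) = 0 := Iff.rfl

lemma single_mem_vectorsOn {A : Finset (Site L)} {s : Site L} (hs : s ∈ A) (j : Fin 2)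
    (t : ZMod 2) : Pi.single (s, j) t ∈ vectorsOn A := by
  intro s' hs' j'
  have : (s', j') ≠ (s, j) := by rintro ⟨⟩; exact hs' hs
  simp [this]

lemma dotProduct_eq_zero_of_vectorsOn {A : Finset (Site L)} {a b : BitVec2 L}
    (ha : a ∈ vectorsOn A) (hb : b ∈ vectorsOn Aᶜ) : b ⬝ᵥ a = 0 := by
  apply Finset.sum_eq_zero
  rintro ⟨s, j⟩ -
  by_cases hs : s ∈ A
  · rw [hb s (by simpa using hs) j, zero_mul]
  · rw [ha s hs j, mul_zero]

/-- Matrix entries of `O_A ⊗ 1`: they vanish between labels that differ outside `A`, and do not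
depend on the common part of the labels outside `A`. -/
lemma supportedOn_iff {A : Finset (Site L)} {O : Op L} :
    SupportedOn A O ↔
      (∀ α γ, O α γ ≠ 0 → ∀ s ∉ A, α s = γ s) ∧
      ∀ α γ α' γ', (∀ s ∈ A, α s = α' s) → (∀ s ∈ A, γ s = γ' s) →
        (∀ s ∉ A, α s = γ s) → (∀ s ∉ A, α' s = γ' s) → O α γ = O α' γ' := by
  constructor
  · rintro ⟨M, rfl⟩
    constructor
    · intro α γ h s hs
      by_contra hne
      apply h
      have : (fun x : {s // s ∉ A} => α x) ≠ fun x : {s // s ∉ A} => γ x :=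
        fun h' => hne (congrFun h' ⟨s, hs⟩)
      simp [Equiv.piEquivPiSubtypeProd, this]
    · intro α γ α' γ' h1 h2 h3 h4
      have e1 : (fun x : {s // s ∈ A} => α x) = fun x : {s // s ∈ A} => α' x :=
        funext fun x => h1 x x.2
      have e2 : (fun x : {s // s ∈ A} => γ x) = fun x : {s // s ∈ A} => γ' x :=
        funext fun x => h2 x x.2
      have e3 : (fun x : {s // s ∉ A} => α x) = fun x : {s // s ∉ A} => γ x :=
        funext fun x => h3 x x.2
      have e4 : (fun x : {s // s ∉ A} => α' x) = fun x : {s // s ∉ A} => γ' x :=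
        funext fun x => h4 x x.2
      simp [Equiv.piEquivPiSubtypeProd, e1, e2, e3, e4]
  · rintro ⟨h1, h2⟩
    let ext0 (f : {s // s ∈ A} → Fin 4) : Config L := fun s => if h : s ∈ A then f ⟨s, h⟩ else 0
    refine ⟨fun f g => O (ext0 f) (ext0 g), ?_⟩
    ext α γ
    change O α γ = O (ext0 fun x => α x) (ext0 fun x => γ x) *
      (1 : Matrix ({s // s ∉ A} → Fin 4) ({s // s ∉ A} → Fin 4) ℂ) (fun x => α x) (fun x => γ x)
    rw [Matrix.one_apply]
    split_ifs with h
    · rw [mul_one]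
      apply h2
      · intro s hs; simp [ext0, hs]
      · intro s hs; simp [ext0, hs]
      · intro s hs; exact congrFun h ⟨s, hs⟩
      · intro s hs; simp [ext0, hs]
    · rw [mul_zero]
      by_contra hne
      exact h (funext fun x => h1 α γ hne x x.2)

lemma SupportedOn.add {A : Finset (Site L)} {O O' : Op L} (h : SupportedOn A O)
    (h' : SupportedOn A O') : SupportedOn A (O + O') := by
  obtain ⟨M, rfl⟩ := h
  obtain ⟨M', rfl⟩ := h'
  exact ⟨M + M', by rw [add_kronecker]; rfl⟩

lemma SupportedOn.smul {A : Finset (Site L)} {O : Op L} (z : ℂ) (h : SupportedOn A O) :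
    SupportedOn A (z • O) := by
  obtain ⟨M, rfl⟩ := h
  exact ⟨z • M, by rw [smul_kronecker]; rfl⟩

lemma supportedOn_shift_mul_phase {A : Finset (Site L)} {a b : BitVec2 L} (ha : a ∈ vectorsOn A)
    (hb : b ∈ vectorsOn A) : SupportedOn A (shift a * phase b) := by
  rw [supportedOn_iff]
  simp only [mul_phase_apply, shift_apply]
  constructor
  · intro α γ h s hs
    have h' : γ = translate a α := by by_contra h'; simp [h'] at h
    rw [← bits_eq_at_iff]
    intro j
    simp [h', ha s hs j]
  · intro α γ α' γ' h1 h2 h3 h4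
    have e1 : (γ = translate a α) ↔ (γ' = translate a α') := by
      rw [eq_translate_iff, eq_translate_iff, funext_iff, funext_iff, Prod.forall, Prod.forall]
      refine forall_congr' fun s => forall_congr' fun j => ?_
      by_cases hs : s ∈ A
      · simp [bits_apply, h1 s hs, h2 s hs]
      · simp [bits_apply, h3 s hs, h4 s hs, ha s hs j]
    have e2 : b ⬝ᵥ bits γ = b ⬝ᵥ bits γ' := by
      refine Finset.sum_congr rfl ?_
      rintro ⟨s, j⟩ -
      by_cases hs : s ∈ A
      · simp [bits_apply, h2 s hs]
      · simp [hb s hs j]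
    simp [e1, e2]

/-- Orthogonality of characters on a space of bit vectors. -/
lemma sum_sign_dotProduct (U : Submodule (ZMod 2) (BitVec2 L)) [Fintype U] (v : BitVec2 L)
    [Decidable (∀ u ∈ U, u ⬝ᵥ v = 0)] :
    ∑ u : U, sign (u.1 ⬝ᵥ v) = if ∀ u ∈ U, u ⬝ᵥ v = 0 then (Fintype.card U : ℂ) else 0 := by
  split_ifs with h
  · simp [h]
  · push Not at h
    obtain ⟨w, hw, hne⟩ := h
    have key : ∑ u : U, sign (u.1 ⬝ᵥ v) = - ∑ u : U, sign (u.1 ⬝ᵥ v) := by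
      rw [← Finset.sum_neg_distrib]
      refine Fintype.sum_equiv (Equiv.addRight (⟨w, hw⟩ : U)) _ _ fun u => ?_
      simp [add_dotProduct, sign_add, sign_of_ne hne]
    exact self_eq_neg.mp key

/-- Every operator on the qudits in `A` is a linear combination of products of shifts and phases
on `A`. -/
lemma SupportedOn.mem_span {A : Finset (Site L)} {O : Op L} (h : SupportedOn A O) :
    O ∈ Submodule.span ℂ
      {X | ∃ a ∈ vectorsOn A, ∃ b ∈ vectorsOn A, X = shift a * phase b} := by
  classical
  rw [supportedOn_iff] at h
  obtain ⟨h1, h2⟩ := h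
  -- The coefficient of `shift a * phase b`, by Fourier inversion along each diagonal of `O`.
  let coeff (a b : BitVec2 L) : ℂ := ∑ γ, O (translate a γ) γ * sign (b ⬝ᵥ bits γ)
  have hN : (Fintype.card (BitVec2 L) : ℂ) ≠ 0 := by simp
  have orth (γ δ : Config L) : ∑ b : BitVec2 L, sign (b ⬝ᵥ bits γ) * sign (b ⬝ᵥ bits δ) =
      if γ = δ then (Fintype.card (BitVec2 L) : ℂ) else 0 := by
    have := sum_sign_dotProduct (⊤ : Submodule (ZMod 2) (BitVec2 L)) (bits γ + bits δ)
    have htop : ∑ b : BitVec2 L, sign (b ⬝ᵥ bits γ) * sign (b ⬝ᵥ bits δ) =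
        ∑ u : (⊤ : Submodule (ZMod 2) (BitVec2 L)), sign (u.1 ⬝ᵥ (bits γ + bits δ)) :=
      (Fintype.sum_equiv Submodule.topEquiv.toEquiv _ _
        fun u => by rw [dotProduct_add, sign_add]; rfl).symm
    rw [htop, this]
    have hiff : (∀ u ∈ (⊤ : Submodule (ZMod 2) (BitVec2 L)), u ⬝ᵥ (bits γ + bits δ) = 0) ↔
        γ = δ := by
      constructor
      · intro hu
        apply bits.injective
        funext i
        have := hu (Pi.single i 1) trivial
        rw [single_dotProduct, one_mul] at this
        exact CharTwo.add_eq_zero.mp this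
      · rintro rfl u -
        simp [ZModModule.add_self]
    simp only [hiff]
    congr 1
    exact_mod_cast Fintype.card_congr
      (Submodule.topEquiv : (⊤ : Submodule (ZMod 2) (BitVec2 L)) ≃ₗ[ZMod 2] _).toEquiv
  have expand : O = (Fintype.card (BitVec2 L) : ℂ)⁻¹ •
      ∑ a, ∑ b, coeff a b • (shift a * phase b) := by
    rw [eq_inv_smul_iff₀ hN]
    ext α γ
    have step (a : BitVec2 L) : ∑ b, coeff a b * ((if γ = translate a α then 1 else 0) *
        sign (b ⬝ᵥ bits γ)) = if γ = translate a α then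
          (Fintype.card (BitVec2 L) : ℂ) * O α γ else 0 := by
      split_ifs with h
      · simp only [one_mul, coeff, Finset.sum_mul]
        rw [Finset.sum_comm]
        simp only [mul_assoc]
        simp only [← Finset.mul_sum, orth]
        simp [h, mul_comm]
      · simp
    simp only [Matrix.smul_apply, Matrix.sum_apply, mul_phase_apply, shift_apply, smul_eq_mul,
      step]
    simp only [eq_translate_iff]
    have (a : BitVec2 L) : (bits γ = bits α + a) ↔ a = bits α + bits γ := by
      constructor
      · intro h; rw [h, ← add_assoc, ZModModule.add_self, zero_add]
      · rintro rfl; rw [← add_assoc, ZModModule.add_self, zero_add]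
    simp only [this, Finset.sum_ite_eq', Finset.mem_univ, if_true]
  rw [expand]
  refine Submodule.smul_mem _ _ (Submodule.sum_mem _ fun a _ => Submodule.sum_mem _ fun b _ => ?_)
  by_cases ha : a ∈ vectorsOn A
  · by_cases hb : b ∈ vectorsOn A
    · exact Submodule.smul_mem _ _ (Submodule.subset_span ⟨a, ha, b, hb, rfl⟩)
    · -- Flipping a bit outside `A` on which `b` is nonzero changes the sign of the coefficient.
      have : coeff a b = 0 := by
        simp only [mem_vectorsOn, not_forall] at hb
        obtain ⟨s, hs, j, hj⟩ := hb
        let v : BitVec2 L := Pi.single (s, j) 1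
        have hv : b ⬝ᵥ v ≠ 0 := by simpa [v, dotProduct_single] using hj
        have key : coeff a b = - coeff a b := by
          simp only [coeff]
          rw [← Finset.sum_neg_distrib]
          refine Fintype.sum_equiv (translatePerm v) _ _ fun γ => ?_
          simp only [translatePerm, Equiv.coe_fn_mk, bits_translate, dotProduct_add, sign_add,
            sign_of_ne hv, mul_neg, mul_one, neg_neg]
          congr 1
          have hvA : v ∈ vectorsOn Aᶜ := single_mem_vectorsOn (by simpa using hs) j 1
          apply h2
          · intro t ht
            rw [← bits_eq_at_iff]
            intro j'
            simp [hvA t (by simpa using ht) j']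
          · intro t ht
            rw [← bits_eq_at_iff]
            intro j'
            simp [hvA t (by simpa using ht) j']
          · intro t ht
            rw [← bits_eq_at_iff]
            intro j'
            simp [ha t ht j']
          · intro t ht
            rw [← bits_eq_at_iff]
            intro j'
            simp [ha t ht j']
        exact self_eq_neg.mp key
      rw [this, zero_smul]
      exact Submodule.zero_mem _
  · have : coeff a b = 0 := by
      apply Finset.sum_eq_zero
      intro γ _
      by_contra hne
      apply ha
      intro s hs j
      have := (bits_eq_at_iff _ _ s).mpr (h1 _ _ (left_ne_zero_of_mul hne) s hs) j
      simpa using this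
    rw [this, zero_smul]
    exact Submodule.zero_mem _

lemma commute_of_supportedOn {A : Finset (Site L)} {O O' : Op L} (h : SupportedOn A O)
    (h' : SupportedOn Aᶜ O') : Commute O O' := by
  refine Submodule.span_induction ?_ (Commute.zero_left _) (fun _ _ _ _ => Commute.add_left)
    (fun z _ _ => fun hc => hc.smul_left z) h.mem_span
  rintro _ ⟨a, ha, b, hb, rfl⟩
  refine Submodule.span_induction ?_ (Commute.zero_right _) (fun _ _ _ _ => Commute.add_right)
    (fun z _ _ => fun hc => hc.smul_right z) h'.mem_span
  rintro _ ⟨a', ha', b', hb', rfl⟩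
  have c1 : Commute (shift a) (shift a') := by
    rw [Commute, SemiconjBy, ← shift_add, ← shift_add, add_comm]
  have c2 : Commute (phase b) (phase b') := by
    rw [Commute, SemiconjBy, ← phase_add, ← phase_add, add_comm]
  have c3 : Commute (shift a) (phase b') := by
    rw [Commute, SemiconjBy, shift_mul_phase, dotProduct_eq_zero_of_vectorsOn ha hb', sign_zero,
      one_smul]
  have c4 : Commute (phase b) (shift a') := by
    rw [Commute, SemiconjBy, phase_mul_shift, dotProduct_comm,
      dotProduct_eq_zero_of_vectorsOn hb ha', sign_zero, one_smul]
  exact (c1.mul_right c3).mul_left (c4.mul_right c2)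

/-! ### The parities shown by a product state -/

lemma Hole.pos (x : Hole L) : 0 < L := lt_of_le_of_lt (Nat.zero_le _) x.1.2

/-- Every side of a qudit is dark or light according to a linear functional of its two bits. -/
lemma darkSide_xor (hL : 0 < L) (s : Site L) (a b : Fin 4) (d : Fin 3) :
    (if DarkSide s (a ^^^ b) d then (1 : ZMod 2) else 0) =
      (if DarkSide s a d then 1 else 0) + if DarkSide s b d then 1 else 0 := by
  simp only [DarkSide, angleDir, hL, dif_pos]
  generalize s _ = e
  revert e d a b
  decide

/-- The parity of the number of dark sides on each lateral of each loop, as a linear map. -/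
def parity : BitVec2 L →ₗ[ZMod 2] (Hole L × Fin 3 → ZMod 2) :=
  AddMonoidHom.toZModLinearMap 2 <| AddMonoidHom.mk'
    (fun v i => (darkCount (bits.symm v) i.1 i.2 : ZMod 2)) <| by
      intro u v
      obtain ⟨α, rfl⟩ := bits.surjective u
      obtain ⟨γ, rfl⟩ := bits.surjective v
      funext ⟨x, c⟩
      simp only [← bits_xor, Equiv.symm_apply_apply, Pi.add_apply, darkCount,
        Finset.natCast_card_filter, ← Finset.sum_add_distrib, darkSide_xor x.pos]

lemma parity_bits (α : Config L) (i : Hole L × Fin 3) :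
    parity (bits α) i = (darkCount α i.1 i.2 : ZMod 2) := by
  change ((darkCount (bits.symm (bits α)) i.1 i.2 : ℕ) : ZMod 2) = _
  rw [Equiv.symm_apply_apply]

lemma odd_darkCount_iff (α : Config L) (x : Hole L) (c : Fin 3) :
    Odd (darkCount α x c) ↔ parity (bits α) (x, c) = 1 := by
  rw [parity_bits, ZMod.natCast_eq_one_iff_odd]

/-- The parities of the three laterals of a loop that shows `b`. -/
def pattern (b : Fin 4) (c : Fin 3) : ZMod 2 := if b ≠ 0 ∧ b ≠ c.succ then 1 else 0

lemma pattern_injective : Function.Injective pattern := by decide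

lemma shows_iff (α : Config L) (x : Hole L) (b : Fin 4) :
    Shows α x b ↔ ∀ c, parity (bits α) (x, c) = pattern b c := by
  refine forall_congr' fun c => ?_
  rw [odd_darkCount_iff, pattern]
  generalize parity (bits α) (x, c) = t
  have h (u : ZMod 2) : u = 0 ∨ u = 1 := by revert u; decide
  rcases h t with rfl | rfl <;> split_ifs with hb <;> simp [hb]

/-! ### The gates -/

lemma Hole.ext_word {x y : Hole L} (h : x.1 = y.1)
    (h' : ∀ (j : Fin L) (hj : j < x.1) (hj' : j < y.1), x.2 ⟨j, hj⟩ = y.2 ⟨j, hj'⟩) : x = y := by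
  obtain ⟨k, x⟩ := x
  obtain ⟨k', y⟩ := y
  obtain rfl : k = k' := h
  congr 1
  funext j
  exact h' (Fin.castLE k.2.le j) j.2 j.2

lemma mem_lateral {x : Hole L} {c : Fin 3} {s : Site L} :
    s ∈ lateral x c ↔ (∀ j : Fin x.1, s (Fin.castLE x.1.2.le j) = x.2 j) ∧ s x.1 = c ∧
      ∀ j, x.1 < j → s j ≠ c := by
  simp [lateral, block]

lemma cornerSite_of_lt {x : Hole L} {c d : Fin 3} {j : Fin L} (h : j < x.1) :
    cornerSite x c d j = x.2 ⟨j, h⟩ := dif_pos h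

lemma cornerSite_self {x : Hole L} {c d : Fin 3} : cornerSite x c d x.1 = c := by
  simp [cornerSite]

lemma cornerSite_of_gt {x : Hole L} {c d : Fin 3} {j : Fin L} (h : x.1 < j) :
    cornerSite x c d j = d := by
  simp [cornerSite, h.not_gt, h.ne']

lemma cornerSite_ne {x : Hole L} {c c' d d' : Fin 3} (h : c ≠ c') :
    cornerSite x c d ≠ cornerSite x c' d' := by
  intro h'
  have := congrFun h' x.1
  rw [cornerSite_self, cornerSite_self] at this
  exact h this

/-- The corner `d ≠ c` of the sub-block `c` of `x` lies on the lateral `c` of the loop around `x`,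
and on the lateral `c` of no other loop. -/
lemma cornerSite_mem_lateral_iff {x y : Hole L} {c d : Fin 3} (h : c ≠ d) :
    cornerSite x c d ∈ lateral y c ↔ y = x := by
  rw [mem_lateral]
  constructor
  · rintro ⟨h1, h2, h3⟩
    have hxy : x.1 = y.1 := by
      rcases lt_trichotomy x.1 y.1 with hlt | heq | hgt
      · rw [cornerSite_of_gt hlt] at h2
        exact absurd h2.symm h
      · exact heq
      · exact absurd cornerSite_self (h3 x.1 hgt)
    refine Hole.ext_word hxy.symm fun j hj hj' => ?_
    rw [← cornerSite_of_lt (c := c) (d := d) hj']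
    exact (h1 ⟨j, hj⟩).symm
  · rintro rfl
    refine ⟨fun j => cornerSite_of_lt (by exact j.2), cornerSite_self, fun j hj => ?_⟩
    rw [cornerSite_of_gt hj]
    exact h.symm

/-- A lateral in direction `d` cannot tell apart two sites that agree on their first letters
and whose remaining letters differ from `d`. -/
lemma mem_lateral_of_agree {k : Fin L} {s t : Site L} {d : Fin 3} (h1 : ∀ j < k, s j = t j)
    (h2 : ∀ j, k ≤ j → s j ≠ d) (h3 : ∀ j, k ≤ j → t j ≠ d) (y : Hole L)
    (h : s ∈ lateral y d) : t ∈ lateral y d := by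
  rw [mem_lateral] at h ⊢
  obtain ⟨ha, hb, hc⟩ := h
  have hk : y.1 < k := by
    by_contra hk
    exact h2 _ (not_lt.mp hk) hb
  refine ⟨fun j => ?_, ?_, fun j hj => ?_⟩
  · rw [← ha j, h1 _ (lt_trans (by exact j.2) hk)]
  · rw [← hb, h1 _ hk]
  · by_cases hjk : j < k
    · rw [← h1 _ hjk]
      exact hc j hj
    · exact h3 j (not_lt.mp hjk)

/-- The bit vector that the gate at the corner `c` of the loop around `x` adds. -/
def gateVec (x : Hole L) (c : Fin 3) : BitVec2 L := bits (gate x c 0)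

lemma bits_gate (x : Hole L) (c : Fin 3) (α : Config L) :
    bits (gate x c α) = bits α + gateVec x c := by
  rw [gateVec, ← bits_xor]
  congr 1
  funext s
  simp only [gate, Pi.zero_apply]
  have h0 (a : Fin 4) : 0 ^^^ a = a := by revert a; decide
  have h1 (a : Fin 4) : a ^^^ 0 = a := by revert a; decide
  split_ifs <;> simp [h0, h1]

/-- The product state with label `a` at `s` and `0` elsewhere. -/
def singleSite (s : Site L) (a : Fin 4) : Config L := Pi.single s a

lemma parity_singleSite (s : Site L) (a : Fin 4) (y : Hole L) (d : Fin 3) :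
    parity (bits (singleSite s a)) (y, d) =
      if s ∈ lateral y d ∧ DarkSide s a d then 1 else 0 := by
  rw [parity_bits, darkCount, Finset.natCast_card_filter]
  have (t : Site L) : (if DarkSide t (singleSite s a t) d then (1 : ZMod 2) else 0) =
      if t = s then if DarkSide s a d then 1 else 0 else 0 := by
    by_cases h : t = s
    · subst h; simp [singleSite]
    · simp [singleSite, h, DarkSide]
  simp only [this, Finset.sum_ite_eq', ite_and]

lemma succ_ne_self (c : Fin 3) : c + 1 ≠ c := by revert c; decide

lemma gateVec_eq (x : Hole L) (c : Fin 3) :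
    gateVec x c =
      bits (singleSite (cornerSite x c (c + 1)) (if (x.1 : ℕ) + 1 = L then 2 else 1)) +
      bits (singleSite (cornerSite x (c + 1) c) (if (x.1 : ℕ) + 1 = L then 3 else 1)) := by
  rw [gateVec, ← bits_xor]
  congr 1
  funext s
  have hne := cornerSite_ne (x := x) (d := c + 1) (d' := c) (succ_ne_self c).symm
  have h0 (a : Fin 4) : 0 ^^^ a = a := by revert a; decide
  have h1 (a : Fin 4) : a ^^^ 0 = a := by revert a; decide
  simp only [gate, singleSite, Pi.single_apply, Pi.zero_apply]
  by_cases hs : s = cornerSite x c (c + 1)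
  · have hs' : s ≠ cornerSite x (c + 1) c := hs ▸ hne
    simp only [hs, if_true, hne, if_false, h0, h1]
  · simp only [hs, if_false, h0]

lemma last_cornerSite (x : Hole L) (c d : Fin 3) (h : L - 1 < L) :
    cornerSite x c d ⟨L - 1, h⟩ = if (x.1 : ℕ) + 1 = L then c else d := by
  split_ifs with hx
  · have : (⟨L - 1, h⟩ : Fin L) = x.1 := by ext; simp; omega
    rw [this, cornerSite_self]
  · exact cornerSite_of_gt (by have := x.1.2; rw [Fin.lt_def]; simp; omega)

/-- At the first corner site of a gate all sides change, except the one opposite to `c + 1`. -/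
lemma darkSide_gate_left (x : Hole L) (c d : Fin 3) :
    DarkSide (cornerSite x c (c + 1)) (if (x.1 : ℕ) + 1 = L then 2 else 1) d ↔ d ≠ c + 1 := by
  simp only [DarkSide, angleDir, x.pos, dif_pos, last_cornerSite]
  split_ifs <;> revert c d <;> decide

/-- At the second corner site of a gate all sides change, except the one opposite to `c`. -/
lemma darkSide_gate_right (x : Hole L) (c d : Fin 3) :
    DarkSide (cornerSite x (c + 1) c) (if (x.1 : ℕ) + 1 = L then 3 else 1) d ↔ d ≠ c := by
  simp only [DarkSide, angleDir, x.pos, dif_pos, last_cornerSite]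
  split_ifs <;> revert c d <;> decide

/-- A gate changes exactly the parities of the two laterals that meet at its corner. The sides
opposite to the third direction also change, but they come in pairs on larger loops. -/
lemma parity_gateVec (x y : Hole L) (c d : Fin 3) :
    parity (gateVec x c) (y, d) = if y = x ∧ d ≠ c + 2 then 1 else 0 := by
  rw [gateVec_eq, map_add, Pi.add_apply, parity_singleSite, parity_singleSite]
  simp only [darkSide_gate_left, darkSide_gate_right]
  have h3 : d = c ∨ d = c + 1 ∨ d = c + 2 := by revert c d; decide
  have n1 := succ_ne_self c
  have n2 : c + 2 ≠ c := (by decide : ∀ c : Fin 3, c + 2 ≠ c) c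
  have n3 : c + 2 ≠ c + 1 := (by decide : ∀ c : Fin 3, c + 2 ≠ c + 1) c
  rcases h3 with rfl | rfl | rfl
  · simp [cornerSite_mem_lateral_iff n1.symm, n1.symm, n2.symm]
  · simp [cornerSite_mem_lateral_iff n1, n1, n3.symm]
  · have h1 (c₁ c₂ c₁' c₂' : Fin 3) : ∀ j < x.1,
        cornerSite x c₁ c₂ j = cornerSite x c₁' c₂' j := fun j hj => by
      rw [cornerSite_of_lt hj, cornerSite_of_lt hj]
    have h2 (c₁ c₂ : Fin 3) (hc₁ : c + 2 ≠ c₁) (hc₂ : c + 2 ≠ c₂) :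
        ∀ j, x.1 ≤ j → cornerSite x c₁ c₂ j ≠ c + 2 := fun j hj => by
      rcases hj.eq_or_lt with rfl | hj
      · rw [cornerSite_self]; exact hc₁.symm
      · rw [cornerSite_of_gt hj]; exact hc₂.symm
    have key : cornerSite x c (c + 1) ∈ lateral y (c + 2) ↔
        cornerSite x (c + 1) c ∈ lateral y (c + 2) :=
      ⟨mem_lateral_of_agree (h1 _ _ _ _) (h2 _ _ n2 n3) (h2 _ _ n3 n2) y,
        mem_lateral_of_agree (h1 _ _ _ _) (h2 _ _ n3 n2) (h2 _ _ n2 n3) y⟩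
    simp only [key, n2, n3, ne_eq, not_false_iff, and_true, not_true, and_false, if_false]
    exact ZModModule.add_self _

/-! ### Independence of the gates -/

/-- The product of the gates at the corners `c` of the loops around `x`, with exponents `n`. -/
def gateComb : (Hole L × Fin 3 → ZMod 2) →ₗ[ZMod 2] BitVec2 L :=
  Fintype.linearCombination (ZMod 2) fun i => gateVec i.1 i.2

lemma gateComb_apply (n : Hole L × Fin 3 → ZMod 2) :
    gateComb n = ∑ x, ∑ c, n (x, c) • gateVec x c := by
  rw [gateComb, Fintype.linearCombination_apply, Fintype.sum_prod_type]

lemma parity_gateComb (n : Hole L × Fin 3 → ZMod 2) (x : Hole L) (c : Fin 3) :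
    parity (gateComb n) (x, c) = n (x, c) + n (x, c + 2) := by
  rw [gateComb_apply]
  simp only [map_sum, map_smul, Finset.sum_apply, Pi.smul_apply, parity_gateVec, smul_eq_mul,
    ite_and]
  rw [Finset.sum_eq_single x]
  · rw [Fin.sum_univ_three]
    fin_cases c
    · simp
    · simpa using add_comm _ _
    · simpa using add_comm _ _
  · intro y _ hy
    simp [hy.symm]
  · simp

/-- The hole at depth `k` whose block contains the site `s`. -/
def holeAt (s : Site L) (k : Fin L) : Hole L := ⟨k, fun j => s (Fin.castLE k.2.le j)⟩

lemma holeAt_congr {s t : Site L} {k : Fin L} (h : ∀ j < k, s j = t j) :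
    holeAt s k = holeAt t k :=
  Hole.ext_word rfl fun j hj _ => h j hj

lemma holeAt_cornerSite (x : Hole L) (c d : Fin 3) : holeAt (cornerSite x c d) x.1 = x :=
  Hole.ext_word rfl fun _ _ hj => cornerSite_of_lt hj

lemma exists_holeAt_eq (x : Hole L) : ∃ s, holeAt s x.1 = x :=
  ⟨cornerSite x 0 0, holeAt_cornerSite x 0 0⟩

lemma eq_cornerSite_iff_of_last {s : Site L} {k : Fin L} (hk : (k : ℕ) + 1 = L) {y : Hole L}
    (hy : (y.1 : ℕ) + 1 = L) (c d : Fin 3) :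
    s = cornerSite y c d ↔ y = holeAt s k ∧ s k = c := by
  have hky : y.1 = k := by ext; omega
  constructor
  · rintro rfl
    subst hky
    exact ⟨(holeAt_cornerSite y c d).symm, cornerSite_self⟩
  · rintro ⟨rfl, rfl⟩
    funext j
    rcases lt_or_eq_of_le (show j ≤ k by rw [Fin.le_def]; omega) with hj | rfl
    · exact (cornerSite_of_lt (x := holeAt s k) hj).symm
    · exact (cornerSite_self (x := holeAt s j)).symm

lemma cornerSite_eq_iff {x y : Hole L} (hx : (x.1 : ℕ) + 1 ≠ L) (hy : (y.1 : ℕ) + 1 ≠ L)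
    {c d c' d' : Fin 3} (h : c ≠ d) (h' : c' ≠ d') :
    cornerSite x c d = cornerSite y c' d' ↔ y = x ∧ c' = c ∧ d' = d := by
  constructor
  · intro e
    have hd : d' = d := by
      have := congrFun e ⟨L - 1, Nat.sub_lt x.pos Nat.one_pos⟩
      rw [last_cornerSite, last_cornerSite, if_neg hx, if_neg hy] at this
      exact this.symm
    subst hd
    have hyx : y.1 = x.1 := by
      rcases lt_trichotomy y.1 x.1 with hlt | heq | hgt
      · have := congrFun e x.1
        rw [cornerSite_self, cornerSite_of_gt hlt] at this
        exact absurd this h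
      · exact heq
      · have := congrFun e y.1
        rw [cornerSite_self, cornerSite_of_gt hgt] at this
        exact absurd this.symm h'
    have hc : c' = c := by
      have := congrFun e x.1
      rw [cornerSite_self, ← hyx, cornerSite_self] at this
      exact this.symm
    subst hc
    refine ⟨((cornerSite_mem_lateral_iff h).mp ?_), rfl, rfl⟩
    rw [e]
    exact (cornerSite_mem_lateral_iff h).mpr rfl
  · rintro ⟨rfl, rfl, rfl⟩
    rfl

lemma gateVec_low (y : Hole L) (c : Fin 3) (s : Site L) :
    gateVec y c (s, 0) =
      (if (y.1 : ℕ) + 1 ≠ L ∧ s = cornerSite y c (c + 1) then 1 else 0) +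
        if s = cornerSite y (c + 1) c then 1 else 0 := by
  have h (t : Site L) (a : Fin 4) :
      bits (singleSite t a) (s, 0) = if s = t then digits a 0 else 0 := by
    rw [bits_apply, singleSite, Pi.single_apply]
    split_ifs
    · rfl
    · decide
  rw [gateVec_eq, Pi.add_apply, h, h]
  by_cases hy : (y.1 : ℕ) + 1 = L
  · simp [hy, show digits 2 0 = 0 by decide, show digits 3 0 = 1 by decide]
  · simp [hy, show digits 1 0 = 1 by decide]

/-- The product of the three gates around `y` acts by `S ^ 1` on the corner sites of the
sub-blocks. On the outer corner `d d ⋯ d` of the lattice this happens only if `y` is a hole of the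
last level. -/
lemma sum_gateVec_low_const {k : Fin L} (hk : (k : ℕ) + 1 = L) (y : Hole L) (d : Fin 3) :
    ∑ c, gateVec y c (fun _ => d, 0) = if y = holeAt (fun _ => d) k then 1 else 0 := by
  simp only [gateVec_low]
  by_cases hy : (y.1 : ℕ) + 1 = L
  · simp only [hy, ne_eq, not_true, false_and, if_false, zero_add,
      eq_cornerSite_iff_of_last hk hy, ite_and]
    split_ifs
    · exact (by decide : ∀ d : Fin 3, (∑ c, if d = c + 1 then (1 : ZMod 2) else 0) = 1) d
    · simp
  · have hne : y ≠ holeAt (fun _ => d) k := by rintro rfl; exact hy hk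
    have h0 {c c' : Fin 3} (hc : c ≠ c') : (fun _ => d) ≠ cornerSite y c c' := by
      intro e
      have e1 := congrFun e y.1
      have e2 := congrFun e ⟨L - 1, Nat.sub_lt y.pos Nat.one_pos⟩
      rw [cornerSite_self] at e1
      rw [last_cornerSite, if_neg hy] at e2
      exact hc (e1.symm.trans e2)
    simp [hne, h0 (succ_ne_self _), h0 (succ_ne_self _).symm]

/-- At an inner corner site, the product of the three gates around `y` acts by `S ^ 1` exactly for
two holes `y`: the one at whose loop the corner lies, and the one of the last level. -/
lemma sum_gateVec_low_cornerSite {k : Fin L} (hk : (k : ℕ) + 1 = L) {x : Hole L}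
    (hx : (x.1 : ℕ) + 1 ≠ L) (y : Hole L) {c d : Fin 3} (h : c ≠ d) :
    ∑ c', gateVec y c' (cornerSite x c d, 0) =
      (if y = holeAt (cornerSite x c d) k then 1 else 0) + if y = x then 1 else 0 := by
  simp only [gateVec_low]
  by_cases hy : (y.1 : ℕ) + 1 = L
  · have hyx : y ≠ x := by rintro rfl; exact hx hy
    simp only [hy, ne_eq, not_true, false_and, if_false, zero_add, hyx, add_zero,
      eq_cornerSite_iff_of_last hk hy, ite_and]
    split_ifs
    · generalize cornerSite x c d k = e
      revert e; decide
    · simp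
  · have hne : y ≠ holeAt (cornerSite x c d) k := by rintro rfl; exact hy hk
    simp only [hy, ne_eq, not_false_iff, true_and, hne, if_false, zero_add,
      cornerSite_eq_iff hx hy h (succ_ne_self _), cornerSite_eq_iff hx hy h (succ_ne_self _).symm,
      ite_and]
    split_ifs
    · clear hne
      revert c d; decide
    · simp

/-- The products of the three gates around each hole are independent. At the inner corner sites
the coefficient of a hole is identified with that of a hole of the last level, which links each
hole to the root hole and to an outer corner of the lattice, where the coefficient is `0`. -/
lemma loops_independent (m : Hole L → ZMod 2) (h : ∑ x, m x • ∑ c, gateVec x c = 0) : m = 0 := by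
  rcases Nat.eq_zero_or_pos L with rfl | hL
  · funext x
    exact absurd x.pos (lt_irrefl 0)
  let k₀ : Fin L := ⟨L - 1, Nat.sub_lt hL Nat.one_pos⟩
  have hk₀ : (k₀ : ℕ) + 1 = L := Nat.sub_add_cancel hL
  have hev (s : Site L) : ∑ x, m x * ∑ c, gateVec x c (s, 0) = 0 := by
    have := congrFun h (s, 0)
    simpa [Finset.sum_apply] using this
  have hconst (d : Fin 3) : m (holeAt (fun _ => d) k₀) = 0 := by
    simpa [sum_gateVec_low_const hk₀] using hev fun _ => d
  have hcorner (x : Hole L) (hx : (x.1 : ℕ) + 1 ≠ L) {c d : Fin 3} (hcd : c ≠ d) :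
      m x = m (holeAt (cornerSite x c d) k₀) := by
    have := hev (cornerSite x c d)
    simp only [sum_gateVec_low_cornerSite hk₀ hx _ hcd, mul_add, Finset.sum_add_distrib, mul_ite,
      mul_one, mul_zero, Finset.sum_ite_eq', Finset.mem_univ, if_true] at this
    exact (CharTwo.add_eq_zero.mp this).symm
  -- If `s` repeats one letter from depth `k` on, the holes around `s` at depth `k` and at the last
  -- level have the same coefficient.
  have key : ∀ (n : ℕ) (k : Fin L), (k : ℕ) + 1 + n = L → ∀ s : Site L,
      (∀ j, k ≤ j → s j = s k) → m (holeAt s k) = m (holeAt s k₀) := by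
    intro n
    induction n with
    | zero =>
      intro k hk s _
      rw [show k = k₀ by ext; omega]
    | succ n ih =>
      intro k hk s hs
      let k' : Fin L := ⟨k + 1, by omega⟩
      have hkk' : k < k' := by rw [Fin.lt_def]; simp [k']
      set t := cornerSite (holeAt s k) (s k) (s k + 1) with ht
      have hts : ∀ j < k', s j = t j := by
        intro j hj
        rcases lt_or_eq_of_le (show j ≤ k by rw [Fin.le_def]; simp [k', Fin.lt_def] at hj; omega)
          with hj | rfl
        · exact (cornerSite_of_lt (x := holeAt s k) hj).symm
        · exact (cornerSite_self (x := holeAt s j)).symm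
      have ht' : ∀ j, k' ≤ j → t j = t k' := fun j hj => by
        rw [ht, cornerSite_of_gt (x := holeAt s k) (hkk'.trans_le hj),
          cornerSite_of_gt (x := holeAt s k) hkk']
      have hs' : ∀ j, k' ≤ j → s j = s k' := fun j hj => by
        rw [hs j (hkk'.le.trans hj), hs k' hkk'.le]
      have hk' : (k' : ℕ) + 1 + n = L := by simp only [k']; omega
      rw [hcorner (holeAt s k) (by simp only [holeAt]; omega) (succ_ne_self (s k)).symm, ← ht,
        ← ih k' hk' t ht', ← holeAt_congr hts, ih k' hk' s hs']
  -- From the root downwards, each hole has the same coefficient as its parent.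
  have main : ∀ (n : ℕ) (k : Fin L), (k : ℕ) = n → ∀ s : Site L, m (holeAt s k) = 0 := by
    intro n
    induction n with
    | zero =>
      intro k hk s
      have hlt : ∀ j < k, s j = (0 : Fin 3) := fun j hj => by rw [Fin.lt_def] at hj; omega
      rw [holeAt_congr (t := fun _ => 0) hlt, key (L - 1) k (by omega) _ (fun _ _ => rfl), hconst]
    | succ n ih =>
      intro k' hk' s
      let k : Fin L := ⟨n, by omega⟩
      have hkk' : k < k' := by rw [Fin.lt_def]; simp [k]; omega
      set t := cornerSite (holeAt s k) (s k) (s k + 1) with ht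
      have hts : ∀ j < k', s j = t j := by
        intro j hj
        rcases lt_or_eq_of_le
          (show j ≤ k by rw [Fin.le_def]; simp [k]; rw [Fin.lt_def] at hj; omega)
          with hj | rfl
        · exact (cornerSite_of_lt (x := holeAt s k) hj).symm
        · exact (cornerSite_self (x := holeAt s _)).symm
      have ht' : ∀ j, k' ≤ j → t j = t k' := fun j hj => by
        rw [ht, cornerSite_of_gt (x := holeAt s k) (hkk'.trans_le hj),
          cornerSite_of_gt (x := holeAt s k) hkk']
      rw [holeAt_congr hts, key (L - 1 - k') k' (by omega) t ht', ht,
        ← hcorner (holeAt s k) (by simp only [holeAt, k]; omega) (succ_ne_self (s k)).symm]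
      exact ih k rfl s
  funext x
  obtain ⟨s, hs⟩ := exists_holeAt_eq x
  rw [← hs]
  exact main _ _ rfl s

lemma gateComb_injective : Function.Injective (gateComb : _ → BitVec2 L) := by
  rw [injective_iff_map_eq_zero]
  intro n hn
  have hp (x : Hole L) (c : Fin 3) : n (x, c) = n (x, c + 2) := by
    have := parity_gateComb n x c
    rw [hn, map_zero] at this
    exact CharTwo.add_eq_zero.mp this.symm
  have hc (x : Hole L) (c : Fin 3) : n (x, c) = n (x, 0) := by
    have h1 := hp x 1
    have h2 := hp x 2
    fin_cases c
    · rfl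
    · exact h1
    · exact h2.trans h1
  have hm : (fun x => n (x, 0)) = 0 := by
    apply loops_independent
    rw [← hn, gateComb_apply]
    refine Finset.sum_congr rfl fun x _ => ?_
    simp only [hc x, Finset.smul_sum]
  funext ⟨x, c⟩
  rw [hc]
  exact congrFun hm x

/-! ### The code as a pair of nested subspaces -/

/-- The span of the gates: the bit vectors of the states `|ψ_m⟩`. -/
def psiSpace (L : ℕ) : Submodule (ZMod 2) (BitVec2 L) := LinearMap.range gateComb

/-- The bit vectors of the states `|ψ_m⟩` that show `0` everywhere. -/
def stabSpace (L : ℕ) : Submodule (ZMod 2) (BitVec2 L) := psiSpace L ⊓ LinearMap.ker parity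

lemma mem_stabSpace {v : BitVec2 L} : v ∈ stabSpace L ↔ v ∈ psiSpace L ∧ parity v = 0 := Iff.rfl

lemma gateVec_mem_psiSpace (x : Hole L) (c : Fin 3) : gateVec x c ∈ psiSpace L :=
  ⟨Pi.single (x, c) 1, by simp [gateComb, Fintype.linearCombination_apply_single]⟩

lemma isPsi_iff (α : Config L) : IsPsi α ↔ bits α ∈ psiSpace L := by
  constructor
  · intro h
    induction h with
    | zero => rw [bits_zero]; exact Submodule.zero_mem _
    | step x c α _ ih => rw [bits_gate]; exact Submodule.add_mem _ ih (gateVec_mem_psiSpace x c)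
  · rintro ⟨n, hn⟩
    have hgate (v : BitVec2 L) (hv : IsPsi (bits.symm v)) (x : Hole L) (c : Fin 3) :
        IsPsi (bits.symm (v + gateVec x c)) := by
      have := IsPsi.step x c _ hv
      rwa [← bits.symm_apply_apply (gate x c (bits.symm v)), bits_gate, bits.apply_symm_apply]
        at this
    have key : ∀ F : Finset (Hole L × Fin 3),
        IsPsi (bits.symm (∑ i ∈ F, n i • gateVec i.1 i.2)) := by
      intro F
      induction F using Finset.induction_on with
      | empty =>
        rw [Finset.sum_empty, ← bits_zero, bits.symm_apply_apply]
        exact IsPsi.zero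
      | insert i F hi ih =>
        rw [Finset.sum_insert hi, add_comm]
        have h (u : ZMod 2) : u = 0 ∨ u = 1 := by revert u; decide
        rcases h (n i) with h | h
        · rwa [h, zero_smul, add_zero]
        · rw [h, one_smul]
          exact hgate _ ih _ _
    have := key Finset.univ
    rwa [← Fintype.linearCombination_apply (ZMod 2) (fun i : Hole L × Fin 3 => gateVec i.1 i.2) n,
      show Fintype.linearCombination (ZMod 2) _ n = gateComb n from rfl, hn,
      bits.symm_apply_apply] at this

/-- In the states `|ψ_m⟩`, an even number of laterals of each loop is odd. -/
lemma parity_lateral_sum {v : BitVec2 L} (hv : v ∈ psiSpace L) (x : Hole L) (c : Fin 3) :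
    parity v (x, c) = parity v (x, c + 1) + parity v (x, c + 2) := by
  obtain ⟨n, rfl⟩ := hv
  have h1 : c + 1 + 2 = c := by revert c; decide
  have h2 : c + 2 + 2 = c + 1 := by revert c; decide
  rw [parity_gateComb, parity_gateComb, parity_gateComb, h1, h2]
  linear_combination -CharTwo.add_self_eq_zero (n (x, c + 1))

lemma exists_shows {α : Config L} (hα : bits α ∈ psiSpace L) :
    ∃ β : BulkConfig L, ∀ x, Shows α x (β x) := by
  have key : ∀ p : Fin 3 → ZMod 2, p 0 = p 1 + p 2 → ∃ b, ∀ c, p c = pattern b c := by decide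
  choose β hβ using fun x => key (fun c => parity (bits α) (x, c)) (parity_lateral_sum hα x 0)
  exact ⟨β, fun x => (shows_iff α x _).mpr (hβ x)⟩

lemma shows_unique {α : Config L} {x : Hole L} {b b' : Fin 4} (h : Shows α x b)
    (h' : Shows α x b') : b = b' :=
  pattern_injective (funext fun c =>
    ((shows_iff α x b).mp h c).symm.trans ((shows_iff α x b').mp h' c))

/-- Exponents of gates that produce the pattern `β`. The summand `m x`, which applies the product
of all three gates around `x`, is the freedom that remains. -/
def exponents (β : BulkConfig L) (m : Hole L → ZMod 2) : Hole L × Fin 3 → ZMod 2 :=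
  fun i => (if β i.1 = i.2.castSucc ∧ i.2 ≠ 0 ∨ β i.1 = 3 ∧ i.2 = 0 then 1 else 0) + m i.1

lemma shows_gateComb_iff (n : Hole L × Fin 3 → ZMod 2) (β : BulkConfig L) :
    (∀ x, Shows (bits.symm (gateComb n)) x (β x)) ↔ n = exponents β fun x => n (x, 1) +
      if β x = 1 then 1 else 0 := by
  simp only [shows_iff, bits.apply_symm_apply, parity_gateComb, funext_iff, Prod.forall]
  refine forall_congr' fun x => ?_
  have key : ∀ (n : Fin 3 → ZMod 2) (b : Fin 4), (∀ c, n c + n (c + 2) = pattern b c) ↔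
      ∀ c, n c = (if b = c.castSucc ∧ c ≠ 0 ∨ b = 3 ∧ c = 0 then 1 else 0) +
        (n 1 + if b = 1 then 1 else 0) := by decide
  exact key (fun c => n (x, c)) (β x)

/-- The number of states `|ψ_m⟩` that show a given pattern. -/
lemma card_shows (β : BulkConfig L) [DecidablePred fun α : Config L =>
    IsPsi α ∧ ∀ x, Shows α x (β x)] :
    (Finset.univ.filter fun α : Config L => IsPsi α ∧ ∀ x, Shows α x (β x)).card =
      2 ^ Fintype.card (Hole L) := by
  have hinj : Function.Injective fun m : Hole L → ZMod 2 =>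
      bits.symm (gateComb (exponents β m)) := by
    intro m m' h
    have := gateComb_injective (bits.symm.injective h)
    funext x
    exact add_left_cancel (congrFun this (x, 0))
  have himage : (Finset.univ.filter fun α : Config L => IsPsi α ∧ ∀ x, Shows α x (β x)) =
      Finset.univ.image fun m : Hole L → ZMod 2 => bits.symm (gateComb (exponents β m)) := by
    ext α
    simp only [Finset.mem_filter, Finset.mem_univ, true_and, Finset.mem_image, isPsi_iff]
    constructor
    · rintro ⟨⟨n, hn⟩, h⟩
      obtain rfl : α = bits.symm (gateComb n) := by rw [hn, bits.symm_apply_apply]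
      exact ⟨_, congrArg _ (congrArg _ ((shows_gateComb_iff n β).mp h).symm)⟩
    · rintro ⟨m, rfl⟩
      refine ⟨by rw [bits.apply_symm_apply]; exact ⟨_, rfl⟩, ?_⟩
      rw [shows_gateComb_iff]
      congr 1
      funext x
      have key : ∀ (b : Fin 4) (t : ZMod 2), t = (if b = Fin.castSucc 1 ∧ (1 : Fin 3) ≠ 0 ∨
          b = 3 ∧ (1 : Fin 3) = 0 then 1 else 0) + t + if b = 1 then 1 else 0 := by decide
      exact key (β x) (m x)
  rw [himage, Finset.card_image_of_injective _ hinj, Finset.card_univ]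
  simp

/-- The squared normalization constant `2 ^ (-K)` of the encoding. -/
noncomputable def weight (L : ℕ) : ℂ := (2 ^ Fintype.card (Hole L))⁻¹

lemma normalization_mul_star :
    ((1 / Real.sqrt (2 ^ Fintype.card (Hole L)) : ℝ) : ℂ) *
      star ((1 / Real.sqrt (2 ^ Fintype.card (Hole L)) : ℝ) : ℂ) = weight L := by
  rw [Complex.star_def, Complex.conj_ofReal, ← Complex.ofReal_mul, div_mul_div_comm, one_mul,
    Real.mul_self_sqrt (by positivity), weight]
  push_cast
  rw [one_div]

lemma encoding_mul_star (α γ : Config L) (β β' : BulkConfig L)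
    [Decidable ((IsPsi α ∧ ∀ x, Shows α x (β x)) ∧ (IsPsi γ ∧ ∀ x, Shows γ x (β' x)))] :
    encoding L α β * star (encoding L γ β') =
      if (IsPsi α ∧ ∀ x, Shows α x (β x)) ∧ (IsPsi γ ∧ ∀ x, Shows γ x (β' x))
        then weight L else 0 := by
  unfold encoding
  by_cases h : IsPsi α ∧ ∀ x, Shows α x (β x)
  · by_cases h' : IsPsi γ ∧ ∀ x, Shows γ x (β' x)
    · rw [if_pos h, if_pos h', if_pos ⟨h, h'⟩, normalization_mul_star]
    · rw [if_neg h', star_zero, mul_zero, if_neg fun hh => h' hh.2]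
  · rw [if_neg h, zero_mul, if_neg fun hh => h hh.1]

/-- The encoding is an isometry. -/
lemma encoding_isometry : (encoding L)ᴴ * encoding L = 1 := by
  classical
  ext β β'
  rw [mul_apply, Matrix.one_apply]
  simp only [conjTranspose_apply, mul_comm (star _), encoding_mul_star]
  split_ifs with h
  · subst h
    simp only [and_self]
    rw [← Finset.sum_filter, Finset.sum_const, card_shows, weight, nsmul_eq_mul]
    push_cast
    exact mul_inv_cancel₀ (by simp)
  · refine Finset.sum_eq_zero fun α _ => if_neg ?_
    rintro ⟨⟨-, h1⟩, -, h2⟩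
    exact h (funext fun x => shows_unique (h2 x) (h1 x))

lemma codeProj_mul_self : codeProj L * codeProj L = codeProj L := by
  rw [codeProj, Matrix.mul_assoc, ← Matrix.mul_assoc (encoding L)ᴴ, encoding_isometry,
    Matrix.one_mul]

lemma shows_all_iff_of_add_mem {α γ : Config L} (h : bits α + bits γ ∈ stabSpace L)
    (β : BulkConfig L) : (∀ x, Shows α x (β x)) ↔ ∀ x, Shows γ x (β x) := by
  have : parity (bits α) = parity (bits γ) := by
    have := (mem_stabSpace.mp h).2
    rw [map_add] at this
    rwa [← sub_eq_zero, sub_eq_add_neg, ZModModule.neg_eq_self]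
  simp only [shows_iff, this]

/-- Entries of an encoded bulk operator that is diagonal in the product basis. -/
lemma encoding_diagonal_apply (f : BulkConfig L → ℂ) (α γ : Config L) :
    (encoding L * diagonal f * (encoding L)ᴴ) α γ =
      ∑ β, f β * (encoding L α β * star (encoding L γ β)) := by
  rw [mul_apply]
  refine Finset.sum_congr rfl fun β _ => ?_
  rw [mul_diagonal, conjTranspose_apply]
  ring

lemma encoding_mul_star_eq (α γ : Config L) (β : BulkConfig L)
    [Decidable (bits α ∈ psiSpace L ∧ bits α + bits γ ∈ stabSpace L)]
    [Decidable (∀ x, Shows α x (β x))] :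
    encoding L α β * star (encoding L γ β) =
      if ∀ x, Shows α x (β x) then
        if bits α ∈ psiSpace L ∧ bits α + bits γ ∈ stabSpace L then weight L else 0
      else 0 := by
  classical
  rw [encoding_mul_star, ← ite_and]
  refine if_congr ?_ rfl rfl
  simp only [isPsi_iff]
  constructor
  · rintro ⟨⟨h1, h2⟩, h3, h4⟩
    refine ⟨h2, h1, mem_stabSpace.mpr ⟨Submodule.add_mem _ h1 h3, ?_⟩⟩
    rw [map_add]
    funext ⟨x, c⟩
    rw [Pi.add_apply, (shows_iff _ _ _).mp (h2 x), (shows_iff _ _ _).mp (h4 x)]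
    exact CharTwo.add_self_eq_zero _
  · rintro ⟨h1, h2, h3⟩
    refine ⟨⟨h2, h1⟩, ?_, (shows_all_iff_of_add_mem h3 β).mp h1⟩
    have := Submodule.add_mem _ h2 h3.1
    rwa [← add_assoc, ZModModule.add_self, zero_add] at this

/-- If the bulk function `f` can be read off from the states `|ψ_m⟩` by the function `h`, then the
encoding maps the diagonal operator of `f` to the one of `h`, restricted to the code space. -/
lemma encoding_diagonal_eq {f : BulkConfig L → ℂ} {h : Config L → ℂ}
    (hfh : ∀ α β, bits α ∈ psiSpace L → (∀ x, Shows α x (β x)) → f β = h α) (α γ : Config L)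
    [Decidable (bits α ∈ psiSpace L ∧ bits α + bits γ ∈ stabSpace L)] :
    (encoding L * diagonal f * (encoding L)ᴴ) α γ =
      if bits α ∈ psiSpace L ∧ bits α + bits γ ∈ stabSpace L then h α * weight L else 0 := by
  classical
  rw [encoding_diagonal_apply]
  simp only [encoding_mul_star_eq]
  split_ifs with hα
  · obtain ⟨β, hβ⟩ := exists_shows hα.1
    rw [Finset.sum_eq_single β]
    · rw [if_pos hβ, hfh α β hα.1 hβ]
    · intro β' _ hne
      rw [if_neg, mul_zero]
      exact fun hβ' => hne (funext fun x => shows_unique (hβ' x) (hβ x))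
    · simp
  · simp

lemma codeProj_apply (α γ : Config L)
    [Decidable (bits α ∈ psiSpace L ∧ bits α + bits γ ∈ stabSpace L)] :
    codeProj L α γ =
      if bits α ∈ psiSpace L ∧ bits α + bits γ ∈ stabSpace L then weight L else 0 := by
  have := encoding_diagonal_eq (L := L) (f := fun _ => 1) (h := fun _ => 1)
    (fun _ _ _ _ => rfl) α γ
  rw [show diagonal (fun _ : BulkConfig L => (1 : ℂ)) = 1 from diagonal_one, Matrix.mul_one,
    one_mul] at this
  exact this

/-! ### Stabilizers and logical operators -/

/-- The bit vectors orthogonal to `U`. -/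
def annihilator (U : Submodule (ZMod 2) (BitVec2 L)) : Submodule (ZMod 2) (BitVec2 L) where
  carrier := {b | ∀ u ∈ U, b ⬝ᵥ u = 0}
  add_mem' ha hb u hu := by rw [add_dotProduct, ha u hu, hb u hu, add_zero]
  zero_mem' u _ := zero_dotProduct u
  smul_mem' c b hb u hu := by rw [smul_dotProduct, hb u hu, smul_zero]

lemma mem_annihilator {U : Submodule (ZMod 2) (BitVec2 L)} {b : BitVec2 L} :
    b ∈ annihilator U ↔ ∀ u ∈ U, b ⬝ᵥ u = 0 := Iff.rfl

lemma annihilator_anti {U U' : Submodule (ZMod 2) (BitVec2 L)} (h : U ≤ U') :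
    annihilator U' ≤ annihilator U := fun _ hb u hu => hb u (h hu)

lemma exists_annihilator_of_notMem {U : Submodule (ZMod 2) (BitVec2 L)} {v : BitVec2 L}
    (hv : v ∉ U) : ∃ b ∈ annihilator U, b ⬝ᵥ v ≠ 0 := by
  obtain ⟨f, hf, hU⟩ := Submodule.exists_le_ker_of_notMem hv
  have h (u : BitVec2 L) : f u = (fun i => f (Pi.single i 1)) ⬝ᵥ u := by
    conv_lhs => rw [pi_eq_sum_univ' u]
    simp [dotProduct, mul_comm]
  refine ⟨fun i => f (Pi.single i 1), fun u hu => ?_, ?_⟩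
  · rw [← h]; exact hU hu
  · rwa [← h]

lemma mem_vectorsOn_compl {A : Finset (Site L)} {b : BitVec2 L}
    (h : b ∈ annihilator (vectorsOn Aᶜ)) : b ∈ vectorsOn A := by
  intro s hs j
  have := h _ (single_mem_vectorsOn (A := Aᶜ) (by simpa using hs) j 1)
  rwa [dotProduct_single, mul_one] at this

lemma mem_of_annihilator {U : Submodule (ZMod 2) (BitVec2 L)} {v : BitVec2 L}
    (h : ∀ b ∈ annihilator U, b ⬝ᵥ v = 0) : v ∈ U := by
  by_contra hv
  obtain ⟨b, hb, hne⟩ := exists_annihilator_of_notMem hv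
  exact hne (h b hb)

/-- The linear algebra of cleaning: a bit vector orthogonal to the part of `U^⊥` on `A` can be
moved to the complement of `A` by adding an element of `U`. -/
lemma exists_add_mem_vectorsOn_compl {A : Finset (Site L)}
    {U : Submodule (ZMod 2) (BitVec2 L)} {v : BitVec2 L}
    (h : ∀ b ∈ annihilator U, b ∈ vectorsOn A → b ⬝ᵥ v = 0) :
    ∃ u ∈ U, ∃ v' ∈ vectorsOn Aᶜ, v = u + v' := by
  have : v ∈ U ⊔ vectorsOn Aᶜ := by
    apply mem_of_annihilator
    intro b hb
    exact h b (annihilator_anti le_sup_left hb)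
      (mem_vectorsOn_compl (annihilator_anti le_sup_right hb))
  obtain ⟨u, hu, v', hv', rfl⟩ := Submodule.mem_sup.mp this
  exact ⟨u, hu, v', hv', rfl⟩

lemma mem_of_mem_annihilator_annihilator {U : Submodule (ZMod 2) (BitVec2 L)} {v : BitVec2 L}
    (h : v ∈ annihilator (annihilator U)) : v ∈ U :=
  mem_of_annihilator fun b hb => by rw [dotProduct_comm]; exact h b hb

lemma stabSpace_le_psiSpace : stabSpace L ≤ psiSpace L := inf_le_left

lemma commute_shift_codeProj {a : BitVec2 L} (ha : a ∈ psiSpace L) :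
    Commute (shift a) (codeProj L) := by
  classical
  ext α γ
  rw [shift_mul_apply, mul_shift_apply, codeProj_apply, codeProj_apply, bits_translate,
    bits_translate, Submodule.add_mem_iff_left _ ha, add_right_comm, add_assoc]

lemma commute_phase_codeProj {b : BitVec2 L} (hb : b ∈ annihilator (stabSpace L)) :
    Commute (phase b) (codeProj L) := by
  classical
  ext α γ
  rw [phase_mul_apply, mul_phase_apply, codeProj_apply]
  split_ifs with h
  · have : sign (b ⬝ᵥ bits α) * sign (b ⬝ᵥ bits γ) = 1 := by
      rw [← sign_add, ← dotProduct_add, hb _ h.2, sign_zero]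
    have h2 := sign_mul_self (b ⬝ᵥ bits γ)
    linear_combination weight L * sign (b ⬝ᵥ bits γ) * this -
      weight L * sign (b ⬝ᵥ bits α) * h2
  · simp

lemma commute_shift_mul_phase_codeProj {a b : BitVec2 L} (ha : a ∈ psiSpace L)
    (hb : b ∈ annihilator (stabSpace L)) : Commute (shift a * phase b) (codeProj L) :=
  (commute_shift_codeProj ha).mul_left (commute_phase_codeProj hb)

lemma shift_mul_codeProj {w : BitVec2 L} (hw : w ∈ stabSpace L) :
    shift w * codeProj L = codeProj L := by
  classical
  ext α γ
  rw [shift_mul_apply, codeProj_apply, codeProj_apply, bits_translate,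
    Submodule.add_mem_iff_left _ (stabSpace_le_psiSpace hw), add_right_comm,
    Submodule.add_mem_iff_left _ hw]

lemma phase_mul_codeProj {b : BitVec2 L} (hb : b ∈ annihilator (psiSpace L)) :
    phase b * codeProj L = codeProj L := by
  classical
  ext α γ
  rw [phase_mul_apply, codeProj_apply]
  split_ifs with h
  · rw [hb _ h.1, sign_zero, one_mul]
  · rw [mul_zero]

/-- An operator that anticommutes with a stabilizer vanishes on the code space. -/
lemma codeProj_conj_eq_zero {D O : Op L} (h : D * codeProj L = codeProj L)
    (hc : Commute D (codeProj L)) (ha : D * O = -(O * D)) :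
    codeProj L * O * codeProj L = 0 := by
  have key : codeProj L * O * codeProj L = -(codeProj L * O * codeProj L) := by
    calc codeProj L * O * codeProj L = codeProj L * (D * O) * codeProj L := by
          rw [← Matrix.mul_assoc (codeProj L) D, ← hc.eq, h]
      _ = -(codeProj L * O * (D * codeProj L)) := by
          rw [ha]; simp only [Matrix.mul_neg, Matrix.neg_mul, Matrix.mul_assoc]
      _ = _ := by rw [h]
  ext α γ
  exact self_eq_neg.mp (congrFun (congrFun key α) γ)

lemma codeProj_conj_shift_mul_phase_eq_zero {a b : BitVec2 L}
    (h : ¬(a ∈ psiSpace L ∧ b ∈ annihilator (stabSpace L))) :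
    codeProj L * (shift a * phase b) * codeProj L = 0 := by
  by_cases ha : a ∈ psiSpace L
  · have hb : b ∉ annihilator (stabSpace L) := fun hb => h ⟨ha, hb⟩
    simp only [mem_annihilator, not_forall] at hb
    obtain ⟨w, hw, hne⟩ := hb
    refine codeProj_conj_eq_zero (shift_mul_codeProj hw)
      (commute_shift_codeProj (stabSpace_le_psiSpace hw)) ?_
    rw [Matrix.mul_assoc, phase_mul_shift, sign_of_ne hne, neg_smul, one_smul, Matrix.mul_neg,
      neg_neg, ← Matrix.mul_assoc, ← Matrix.mul_assoc, ← shift_add, ← shift_add, add_comm]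
  · obtain ⟨b', hb', hne⟩ := exists_annihilator_of_notMem ha
    refine codeProj_conj_eq_zero (phase_mul_codeProj hb')
      (commute_phase_codeProj (annihilator_anti stabSpace_le_psiSpace hb')) ?_
    rw [← Matrix.mul_assoc, phase_mul_shift, sign_of_ne hne, neg_smul, one_smul, Matrix.neg_mul,
      Matrix.mul_assoc, Matrix.mul_assoc, ← phase_add, ← phase_add, add_comm]

/-! ### The center of the algebra of reconstructible operators -/

lemma mul_codeProj_mem_recon {A : Finset (Site L)} {O : Op L} (h : SupportedOn A O)
    (hc : Commute O (codeProj L)) : O * codeProj L ∈ recon A :=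
  ⟨O, h, hc.eq, by rw [← hc.eq, Matrix.mul_assoc, codeProj_mul_self]⟩

lemma exists_eq_mul_codeProj {A : Finset (Site L)} {X : Op L} (h : X ∈ recon A) :
    ∃ O, SupportedOn A O ∧ Commute O (codeProj L) ∧ X = O * codeProj L := by
  obtain ⟨O, hO, hc, rfl⟩ := h
  exact ⟨O, hO, hc, by rw [← hc, Matrix.mul_assoc, codeProj_mul_self]⟩

lemma codeProj_conj_of_mem_recon {A : Finset (Site L)} {X : Op L} (h : X ∈ recon A) :
    codeProj L * X * codeProj L = X := by
  obtain ⟨O, hO, hc, rfl⟩ := exists_eq_mul_codeProj h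
  rw [← Matrix.mul_assoc, ← hc.eq, Matrix.mul_assoc, Matrix.mul_assoc, codeProj_mul_self,
    codeProj_mul_self]

lemma add_mem_recon {A : Finset (Site L)} {X Y : Op L} (hX : X ∈ recon A) (hY : Y ∈ recon A) :
    X + Y ∈ recon A := by
  obtain ⟨O, hO, hc, rfl⟩ := exists_eq_mul_codeProj hX
  obtain ⟨O', hO', hc', rfl⟩ := exists_eq_mul_codeProj hY
  rw [← Matrix.add_mul]
  exact mul_codeProj_mem_recon (hO.add hO') (hc.add_left hc')

lemma smul_mem_recon {A : Finset (Site L)} {X : Op L} (z : ℂ) (hX : X ∈ recon A) :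
    z • X ∈ recon A := by
  obtain ⟨O, hO, hc, rfl⟩ := exists_eq_mul_codeProj hX
  rw [← Matrix.smul_mul]
  exact mul_codeProj_mem_recon (hO.smul z) (hc.smul_left z)

lemma shift_mul_phase_mul_codeProj_mem_recon {A : Finset (Site L)} {a b : BitVec2 L}
    (ha : a ∈ psiSpace L) (hb : b ∈ annihilator (stabSpace L)) (ha' : a ∈ vectorsOn A)
    (hb' : b ∈ vectorsOn A) : shift a * phase b * codeProj L ∈ recon A :=
  mul_codeProj_mem_recon (supportedOn_shift_mul_phase ha' hb')
    (commute_shift_mul_phase_codeProj ha hb)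

lemma zero_mem_recon (A : Finset (Site L)) : (0 : Op L) ∈ recon A := by
  have := smul_mem_recon 0 (shift_mul_phase_mul_codeProj_mem_recon (A := A)
    (Submodule.zero_mem (psiSpace L)) (Submodule.zero_mem _) (Submodule.zero_mem _)
    (Submodule.zero_mem _))
  rwa [zero_smul] at this

lemma mul_comm_of_mem_recon_compl {A : Finset (Site L)} {X Y : Op L} (hX : X ∈ recon A)
    (hY : Y ∈ recon Aᶜ) : X * Y = Y * X := by
  obtain ⟨O, hO, hc, rfl⟩ := exists_eq_mul_codeProj hX
  obtain ⟨O', hO', hc', rfl⟩ := exists_eq_mul_codeProj hY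
  have h1 : Commute O (O' * codeProj L) := (commute_of_supportedOn hO hO').mul_right hc
  have h2 : Commute (codeProj L) (O' * codeProj L) := hc'.symm.mul_right (Commute.refl _)
  exact (h1.mul_left h2).eq

/-- The sum over the conjugates of `X` by all products of shifts in `U` and phases in `V`. -/
noncomputable def twirl (U V : Submodule (ZMod 2) (BitVec2 L)) : Op L →ₗ[ℂ] Op L := by
  classical
  exact ∑ u : U, ∑ v : V, LinearMap.mulLeft ℂ (shift u.1 * phase v.1) ∘ₗ
    LinearMap.mulRight ℂ (phase v.1 * shift u.1)

open Classical in
lemma twirl_apply (U V : Submodule (ZMod 2) (BitVec2 L)) (X : Op L) :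
    twirl U V X = ∑ u : U, ∑ v : V,
      shift u.1 * phase v.1 * (X * (phase v.1 * shift u.1)) := by
  simp [twirl, LinearMap.sum_apply, Matrix.mul_assoc]

lemma shift_mul_phase_mul_inv (u v : BitVec2 L) :
    shift u * phase v * (phase v * shift u) = 1 := by
  rw [Matrix.mul_assoc, ← Matrix.mul_assoc (phase v), phase_mul_self, Matrix.one_mul,
    shift_mul_self]

open Classical in
lemma twirl_of_commute {U V : Submodule (ZMod 2) (BitVec2 L)} {X : Op L}
    (h : ∀ u ∈ U, ∀ v ∈ V, X * (shift u * phase v) = shift u * phase v * X) :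
    twirl U V X = ((Fintype.card U : ℂ) * Fintype.card V) • X := by
  have (u : U) (v : V) : shift u.1 * phase v.1 * (X * (phase v.1 * shift u.1)) = X := by
    rw [← Matrix.mul_assoc, ← h u u.2 v v.2, Matrix.mul_assoc, shift_mul_phase_mul_inv,
      Matrix.mul_one]
  rw [twirl_apply]
  simp only [this, Finset.sum_const, Finset.card_univ, smul_smul, ← Nat.cast_smul_eq_nsmul ℂ]

open Classical in
/-- Twirling a product of a shift and a phase keeps it up to a factor if it commutes with all
elements of the group, and annihilates it otherwise. -/
lemma twirl_shift_mul_phase {U V : Submodule (ZMod 2) (BitVec2 L)} (hU : U ≤ psiSpace L)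
    (hV : V ≤ annihilator (stabSpace L)) (a b : BitVec2 L) :
    twirl U V (shift a * phase b * codeProj L) =
      ((∑ u : U, sign (u.1 ⬝ᵥ b)) * ∑ v : V, sign (v.1 ⬝ᵥ a)) •
        (shift a * phase b * codeProj L) := by
  rw [twirl_apply, Finset.sum_mul, Finset.sum_smul]
  refine Finset.sum_congr rfl fun u _ => ?_
  rw [Finset.mul_sum, Finset.sum_smul]
  refine Finset.sum_congr rfl fun v _ => ?_
  obtain ⟨u, hu⟩ := u
  obtain ⟨v, hv⟩ := v
  simp only
  have hq : Commute (codeProj L) (phase v * shift u) :=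
    (commute_phase_codeProj (hV hv)).symm.mul_right (commute_shift_codeProj (hU hu)).symm
  have hs : shift u * shift a = shift a * shift u := by
    rw [← shift_add, ← shift_add, add_comm]
  have hp : phase v * phase b = phase b * phase v := by
    rw [← phase_add, ← phase_add, add_comm]
  have e : shift u * phase v * (shift a * phase b) =
      (sign (u ⬝ᵥ b) * sign (v ⬝ᵥ a)) • (shift a * phase b * (shift u * phase v)) := by
    calc shift u * phase v * (shift a * phase b)
        = shift u * (phase v * shift a) * phase b := by simp only [Matrix.mul_assoc]
      _ = sign (v ⬝ᵥ a) • (shift u * shift a * (phase v * phase b)) := by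
          rw [phase_mul_shift, Matrix.mul_smul, Matrix.smul_mul]
          simp only [Matrix.mul_assoc]
      _ = sign (v ⬝ᵥ a) • (shift a * (shift u * phase b) * phase v) := by
          rw [hs, hp]; simp only [Matrix.mul_assoc]
      _ = _ := by
          rw [shift_mul_phase, dotProduct_comm b u, Matrix.mul_smul, Matrix.smul_mul, smul_smul,
            mul_comm (sign (v ⬝ᵥ a))]
          simp only [Matrix.mul_assoc]
  have hinv := shift_mul_phase_mul_inv u v
  generalize shift a * phase b = p at e ⊢
  generalize shift u * phase v = q at e hinv ⊢
  generalize phase v * shift u = q' at hq hinv ⊢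
  calc q * (p * codeProj L * q') = q * p * (q' * codeProj L) := by
        rw [Matrix.mul_assoc p, hq.eq, Matrix.mul_assoc q]
    _ = (sign (u ⬝ᵥ b) * sign (v ⬝ᵥ a)) • (p * (q * q') * codeProj L) := by
        rw [e, Matrix.smul_mul]; simp only [Matrix.mul_assoc]
    _ = _ := by rw [hinv, Matrix.mul_one]

/-- A logical operator on `A` that commutes with all logical products of shifts and phases on `A`
can be reconstructed on the complement of `A`: twirling it leaves only products of shifts and
phases that can be moved to the complement by multiplication with stabilizers. -/
lemma mem_recon_compl_of_commute {A : Finset (Site L)} {X : Op L} (hX : X ∈ recon A)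
    (hc : ∀ Y ∈ recon A, X * Y = Y * X) : X ∈ recon Aᶜ := by
  classical
  set U := psiSpace L ⊓ vectorsOn A with hU
  set V := annihilator (stabSpace L) ⊓ vectorsOn A with hV
  have hUle : U ≤ psiSpace L := inf_le_left
  have hVle : V ≤ annihilator (stabSpace L) := inf_le_left
  have hXP := codeProj_conj_of_mem_recon hX
  have hXr : X * codeProj L = X := by
    rw [← hXP, Matrix.mul_assoc, codeProj_mul_self]
  have hXl : codeProj L * X = X := by
    rw [← hXP, ← Matrix.mul_assoc, ← Matrix.mul_assoc, codeProj_mul_self]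
  have hcomm : ∀ u ∈ U, ∀ v ∈ V, X * (shift u * phase v) = shift u * phase v * X := by
    intro u hu v hv
    have hq := commute_shift_mul_phase_codeProj hu.1 hv.1
    have := hc _ (shift_mul_phase_mul_codeProj_mem_recon hu.1 hv.1 hu.2 hv.2)
    rw [Matrix.mul_assoc _ _ X, hXl, hq.eq, ← Matrix.mul_assoc, hXr] at this
    exact this
  have htw := twirl_of_commute hcomm
  have hcard : ((Fintype.card U : ℂ) * Fintype.card V) ≠ 0 := by
    simp [Fintype.card_ne_zero]
  rw [← inv_smul_eq_iff₀ hcard] at htw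
  rw [← htw]
  apply smul_mem_recon
  obtain ⟨O, hO, -, rfl⟩ := hX
  refine Submodule.span_induction (p := fun O _ => twirl U V (codeProj L * O * codeProj L) ∈
    recon Aᶜ) ?_ ?_ ?_ ?_ hO.mem_span
  · rintro _ ⟨a, ha, b, hb, rfl⟩
    by_cases h : a ∈ psiSpace L ∧ b ∈ annihilator (stabSpace L)
    · have hq := commute_shift_mul_phase_codeProj h.1 h.2
      rw [← hq.eq, Matrix.mul_assoc _ (codeProj L), codeProj_mul_self,
        twirl_shift_mul_phase hUle hVle, sum_sign_dotProduct, sum_sign_dotProduct]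
      split_ifs with h1 h2
      · apply smul_mem_recon
        obtain ⟨w, hw, a', ha', rfl⟩ := exists_add_mem_vectorsOn_compl (A := A)
          (U := stabSpace L) (v := a) fun v hv hvA => h2 v ⟨hv, hvA⟩
        obtain ⟨w', hw', b', hb', rfl⟩ := exists_add_mem_vectorsOn_compl (A := A)
          (U := annihilator (psiSpace L)) (v := b)
          fun u hu huA => h1 u ⟨mem_of_mem_annihilator_annihilator hu, huA⟩
        have ha'' : a' ∈ psiSpace L :=
          (Submodule.add_mem_iff_right _ (stabSpace_le_psiSpace hw)).mp h.1
        have hb'' : b' ∈ annihilator (stabSpace L) :=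
          (Submodule.add_mem_iff_right _ (annihilator_anti stabSpace_le_psiSpace hw')).mp h.2
        have hq' := commute_shift_mul_phase_codeProj ha'' hb''
        have e : shift (w + a') * phase (w' + b') * codeProj L =
            shift a' * phase b' * codeProj L := by
          rw [add_comm w', phase_add, shift_add, Matrix.mul_assoc _ _ (codeProj L),
            Matrix.mul_assoc (phase b'), phase_mul_codeProj hw', Matrix.mul_assoc (shift w),
            ← Matrix.mul_assoc (shift a'), hq'.eq, ← Matrix.mul_assoc, shift_mul_codeProj hw]
        rw [e]
        exact shift_mul_phase_mul_codeProj_mem_recon ha'' hb'' ha' hb'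
      all_goals simpa using zero_mem_recon _
    · rw [codeProj_conj_shift_mul_phase_eq_zero h, map_zero]
      exact zero_mem_recon _
  · simpa using zero_mem_recon _
  · intro O O' _ _ h h'
    rw [Matrix.mul_add, Matrix.add_mul, map_add]
    exact add_mem_recon h h'
  · intro z O _ h
    rw [Matrix.mul_smul, Matrix.smul_mul, map_smul]
    exact smul_mem_recon z h

lemma codeCenter_recon (A : Finset (Site L)) :
    codeCenter (recon A) = recon A ∩ recon Aᶜ := by
  ext X
  constructor
  · rintro ⟨hX, -, hc⟩
    exact ⟨hX, mem_recon_compl_of_commute hX hc⟩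
  · rintro ⟨hX, hX'⟩
    exact ⟨hX, codeProj_conj_of_mem_recon hX, fun Y hY => (mul_comm_of_mem_recon_compl hY hX').symm⟩

/-! ### Bulk projections in the center -/

/-- The eigenvalues of the projection onto `|b⟩` and `|b'⟩` at the hole `x`. -/
def pairIndicator (x : Hole L) (b b' : Fin 4) (β : BulkConfig L) : ℂ :=
  if β x = b ∨ β x = b' then 1 else 0

lemma bulkLocal_pair_eq_diagonal (x : Hole L) {b b' : Fin 4} (hne : b ≠ b') :
    bulkLocal x (Matrix.single b b 1 + Matrix.single b' b' 1) =
      diagonal (pairIndicator x b b') := by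
  ext β γ
  simp only [bulkLocal, diagonal_apply, Matrix.add_apply, Matrix.single_apply, pairIndicator]
  by_cases h : β = γ
  · subst h
    by_cases h1 : β x = b
    · have h2 : β x ≠ b' := h1 ▸ hne
      simp [h1, hne.symm]
    · simp [h1, Ne.symm h1, eq_comm]
  · rw [if_neg h]
    split_ifs with hy h1 h2 h2
    · exact absurd (h1.1.trans h2.1.symm) hne
    all_goals try simp
    all_goals
      exfalso
      apply h
      funext y
      by_cases hyx : y = x
      · subst hyx
        first
          | exact h1.1.symm.trans h1.2
          | exact h2.1.symm.trans h2.2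
      · exact hy y hyx

lemma pairProj_eq (x : Hole L) {b b' : Fin 4} (hne : b ≠ b') :
    pairProj x b b' = encoding L * diagonal (pairIndicator x b b') * (encoding L)ᴴ := by
  rw [pairProj, bulkLocal_pair_eq_diagonal x hne]

lemma encoding_conj_pairProj (x : Hole L) {b b' : Fin 4} (hne : b ≠ b') :
    (encoding L)ᴴ * pairProj x b b' * encoding L = diagonal (pairIndicator x b b') := by
  rw [pairProj_eq x hne, ← Matrix.mul_assoc, ← Matrix.mul_assoc, encoding_isometry,
    Matrix.one_mul, Matrix.mul_assoc, encoding_isometry, Matrix.mul_one]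

lemma pairIndicator_ne_smul_one (x : Hole L) (b b' : Fin 4) (z : ℂ) :
    diagonal (pairIndicator x b b') ≠ z • (1 : BulkOp L) := by
  intro h
  have hd (a : Fin 4) : (if a = b ∨ a = b' then (1 : ℂ) else 0) = z := by
    have := congrFun (congrFun h fun _ => a) fun _ => a
    simpa [pairIndicator] using this
  obtain ⟨a, h1, h2⟩ : ∃ a : Fin 4, a ≠ b ∧ a ≠ b' :=
    (by decide : ∀ b b' : Fin 4, ∃ a, a ≠ b ∧ a ≠ b') b b'
  have h0 := hd a
  have h1' := hd b
  rw [if_neg (by tauto)] at h0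
  rw [if_pos (Or.inl rfl), ← h0] at h1'
  exact one_ne_zero h1'

lemma pairProj_ne_smul_codeProj (x : Hole L) {b b' : Fin 4} (hne : b ≠ b') (z : ℂ) :
    pairProj x b b' ≠ z • codeProj L := by
  intro h
  apply pairIndicator_ne_smul_one x b b' z
  rw [← encoding_conj_pairProj x hne, h, codeProj, Matrix.mul_smul, Matrix.smul_mul,
    ← Matrix.mul_assoc, encoding_isometry, Matrix.one_mul, encoding_isometry]

lemma encoding_conj_mem_bulkCenter {A : Finset (Site L)} {X : Op L}
    (h : X ∈ codeCenter (recon A)) :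
    (encoding L)ᴴ * X * encoding L ∈ bulkCenter (bulkRecon A) := by
  obtain ⟨hX, hP, hc⟩ := h
  refine ⟨⟨X, hX, rfl⟩, ?_⟩
  rintro _ ⟨Y, hY, rfl⟩
  have hl {Z : Op L} (hZ : Z ∈ recon A) : codeProj L * Z = Z := by
    rw [← codeProj_conj_of_mem_recon hZ, ← Matrix.mul_assoc, ← Matrix.mul_assoc,
      codeProj_mul_self]
  have hmul {Z Z' : Op L} (hZ' : Z' ∈ recon A) :
      (encoding L)ᴴ * Z * encoding L * ((encoding L)ᴴ * Z' * encoding L) =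
        (encoding L)ᴴ * (Z * Z') * encoding L := by
    calc _ = (encoding L)ᴴ * (Z * (encoding L * (encoding L)ᴴ * Z')) * encoding L := by
          simp only [Matrix.mul_assoc]
      _ = _ := by rw [← codeProj, hl hZ']
  simp only
  rw [hmul hX, hmul hY, hc Y hY]

lemma supportedOn_diagonal {A : Finset (Site L)} {h : Config L → ℂ}
    (hA : ∀ α γ : Config L, (∀ s ∈ A, α s = γ s) → h α = h γ) : SupportedOn A (diagonal h) := by
  rw [supportedOn_iff]
  constructor
  · intro α γ hne s _
    have : α = γ := by
      by_contra h'
      exact hne (diagonal_apply_ne h h')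
    rw [this]
  · intro α γ α' γ' h1 h2 h3 h4
    have e : α = γ ↔ α' = γ' := by
      constructor <;> rintro rfl <;> funext s <;> by_cases hs : s ∈ A
      · rw [← h1 s hs, h2 s hs]
      · exact h4 s hs
      · rw [h1 s hs, ← h2 s hs]
      · exact h3 s hs
    simp only [diagonal_apply, e, hA α α' h1]

/-- A bulk projection can be reconstructed on `A` if it can be read off from the qudits in `A` in
the states `|ψ_m⟩`. -/
lemma pairProj_mem_recon {A : Finset (Site L)} {x : Hole L} {b b' : Fin 4} (hne : b ≠ b')
    {h : Config L → ℂ} (hA : ∀ α γ : Config L, (∀ s ∈ A, α s = γ s) → h α = h γ)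
    (hb : ∀ α β, bits α ∈ psiSpace L → (∀ y, Shows α y (β y)) → pairIndicator x b b' β = h α) :
    pairProj x b b' ∈ recon A := by
  classical
  have he : pairProj x b b' = diagonal h * codeProj L := by
    ext α γ
    rw [pairProj_eq x hne, encoding_diagonal_eq hb, diagonal_mul, codeProj_apply, mul_ite, mul_zero]
  rw [he]
  refine mul_codeProj_mem_recon (supportedOn_diagonal hA) ?_
  ext α γ
  rw [diagonal_mul, mul_diagonal, codeProj_apply]
  split_ifs with hαγ
  · obtain ⟨β, hβ⟩ := exists_shows hαγ.1
    have hγ : bits γ ∈ psiSpace L :=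
      (Submodule.add_mem_iff_right _ hαγ.1).mp (stabSpace_le_psiSpace hαγ.2)
    rw [← hb α β hαγ.1 hβ, ← hb γ β hγ ((shows_all_iff_of_add_mem hαγ.2 β).mp hβ), mul_comm]
  · simp

lemma parity_congr {x : Hole L} {c : Fin 3} {α γ : Config L} (h : ∀ s ∈ lateral x c, α s = γ s) :
    parity (bits α) (x, c) = parity (bits γ) (x, c) := by
  rw [parity_bits, parity_bits, darkCount, darkCount]
  congr 2
  refine Finset.filter_congr fun s hs => ?_
  rw [h s hs]

/-- The parity of the lateral `c` is measured on `A`; in the states `|ψ_m⟩` it agrees with the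
total parity of the other two laterals, which is measured on the complement. -/
lemma pairProj_mem_recon_inter {A : Finset (Site L)} {x : Hole L} {c : Fin 3}
    (h₀ : lateral x c ⊆ A) (h₁ : lateral x (c + 1) ⊆ Aᶜ) (h₂ : lateral x (c + 2) ⊆ Aᶜ)
    {t : ZMod 2} {b b' : Fin 4} (hne : b ≠ b') (hb : ∀ a, a = b ∨ a = b' ↔ pattern a c = t) :
    pairProj x b b' ∈ recon A ∩ recon Aᶜ := by
  constructor
  · refine pairProj_mem_recon hne (h := fun α => if parity (bits α) (x, c) = t then 1 else 0)
      (fun α γ h => ?_) fun α β hα hβ => ?_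
    · simp only [parity_congr fun s hs => h s (h₀ hs)]
    · rw [pairIndicator, (shows_iff _ _ _).mp (hβ x)]
      simp only [hb]
  · refine pairProj_mem_recon hne (h := fun α => if parity (bits α) (x, c + 1) +
      parity (bits α) (x, c + 2) = t then 1 else 0) (fun α γ h => ?_) fun α β hα hβ => ?_
    · simp only [parity_congr fun s hs => h s (h₁ hs), parity_congr fun s hs => h s (h₂ hs)]
    · rw [pairIndicator, ← parity_lateral_sum hα, (shows_iff _ _ _).mp (hβ x)]
      simp only [hb]

/-- An enumeration of the labels that lists first the two with an even lateral `c`, which are `0`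
and `c + 1`, and then the two with an odd one. -/
def pairing (c : Fin 3) : Equiv.Perm (Fin 4) := Equiv.swap 1 c.succ

lemma pairing_pattern_zero (c : Fin 3) (a : Fin 4) :
    a = pairing c 0 ∨ a = pairing c 1 ↔ pattern a c = 0 := by
  revert a c; decide

lemma pairing_pattern_one (c : Fin 3) (a : Fin 4) :
    a = pairing c 2 ∨ a = pairing c 3 ↔ pattern a c = 1 := by
  revert a c; decide

/-! ### The smallest split block -/

lemma mem_block {x : Hole L} {s : Site L} :
    s ∈ block x ↔ ∀ j : Fin x.1, s (Fin.castLE x.1.2.le j) = x.2 j := by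
  simp [block]

lemma mem_block_holeAt {s t : Site L} {k : Fin L} :
    t ∈ block (holeAt s k) ↔ ∀ j < k, t j = s j := by
  rw [mem_block]
  exact ⟨fun h j hj => h ⟨j, hj⟩, fun h j => h _ j.2⟩

lemma lateral_subset_block (x : Hole L) (c : Fin 3) : lateral x c ⊆ block x :=
  Finset.filter_subset _ _

/-- The root block is split, so there is a split block of maximal depth. -/
lemma exists_deepest_split {A : Finset (Site L)} (hA : A.Nonempty) (hA' : Aᶜ.Nonempty) :
    ∃ x : Hole L, Splits A x ∧ ∀ y : Hole L, x.1 < y.1 → ¬ Splits A y := by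
  classical
  obtain ⟨s, hs⟩ := hA
  obtain ⟨t, ht⟩ := hA'
  have hL : 0 < L := by
    rcases Nat.eq_zero_or_pos L with rfl | h
    · rw [Subsingleton.elim t s, Finset.mem_compl] at ht
      exact absurd hs ht
    · exact h
  let k : Fin L := ⟨0, hL⟩
  have hk : ∀ j : Fin L, ¬ j < k := fun j => Nat.not_lt_zero _
  have hroot : Splits A (holeAt s k) :=
    ⟨⟨s, Finset.mem_inter.mpr ⟨mem_block_holeAt.mpr fun j hj => absurd hj (hk j), hs⟩⟩,
      ⟨t, Finset.mem_inter.mpr ⟨mem_block_holeAt.mpr fun j hj => absurd hj (hk j), ht⟩⟩⟩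
  obtain ⟨x, hx, hmax⟩ := Finset.exists_max_image (Finset.univ.filter (Splits A)) (fun x => x.1)
    ⟨_, Finset.mem_filter.mpr ⟨Finset.mem_univ _, hroot⟩⟩
  refine ⟨x, (Finset.mem_filter.mp hx).2, fun y hy hsplit => ?_⟩
  exact absurd (hmax y (Finset.mem_filter.mpr ⟨Finset.mem_univ _, hsplit⟩)) hy.not_ge

/-- Each sub-block of a split block of maximal depth lies on one side. -/
lemma subblock_mem_iff {A : Finset (Site L)} {x : Hole L}
    (hx : ∀ y : Hole L, x.1 < y.1 → ¬ Splits A y) {s t : Site L} (hs : s ∈ block x)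
    (ht : t ∈ block x) (hst : s x.1 = t x.1) : s ∈ A → t ∈ A := by
  intro hsA
  by_contra htA
  have hagree : ∀ j ≤ x.1, t j = s j := by
    intro j hj
    rcases hj.lt_or_eq with hj | rfl
    · exact (mem_block.mp ht ⟨j, hj⟩).trans (mem_block.mp hs ⟨j, hj⟩).symm
    · exact hst.symm
  by_cases hlast : (x.1 : ℕ) + 1 = L
  · have : t = s := funext fun j => hagree j (by rw [Fin.le_def]; omega)
    exact htA (this ▸ hsA)
  · let k : Fin L := ⟨x.1 + 1, by have := x.1.2; omega⟩
    refine hx (holeAt s k) (by rw [Fin.lt_def]; simp [holeAt, k]) ⟨⟨s, ?_⟩, ⟨t, ?_⟩⟩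
    · exact Finset.mem_inter.mpr ⟨mem_block_holeAt.mpr fun _ _ => rfl, hsA⟩
    · refine Finset.mem_inter.mpr ⟨mem_block_holeAt.mpr fun j hj => hagree j ?_,
        Finset.mem_compl.mpr htA⟩
      rw [Fin.lt_def] at hj
      rw [Fin.le_def]
      exact Nat.le_of_lt_succ hj

/-- One of the three sub-blocks of a split block of maximal depth is separated from the other
two. -/
lemma exists_separated_lateral {A : Finset (Site L)} {x : Hole L} (hs : Splits A x)
    (hx : ∀ y : Hole L, x.1 < y.1 → ¬ Splits A y) :
    ∃ c, (lateral x c ⊆ A ∧ lateral x (c + 1) ⊆ Aᶜ ∧ lateral x (c + 2) ⊆ Aᶜ) ∨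
      (lateral x c ⊆ Aᶜ ∧ lateral x (c + 1) ⊆ A ∧ lateral x (c + 2) ⊆ A) := by
  classical
  let p (c : Fin 3) : Bool := ∃ s ∈ block x, s x.1 = c ∧ s ∈ A
  have hp (c : Fin 3) : p c = true ↔ ∃ s ∈ block x, s x.1 = c ∧ s ∈ A := by simp [p]
  have hpos {c : Fin 3} (h : p c = true) : lateral x c ⊆ A := by
    obtain ⟨s, hsx, hsc, hsA⟩ := (hp c).mp h
    intro t ht
    exact subblock_mem_iff hx hsx (lateral_subset_block x c ht)
      (hsc.trans (mem_lateral.mp ht).2.1.symm) hsA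
  have hneg {c : Fin 3} (h : p c = false) : lateral x c ⊆ Aᶜ := by
    intro t ht
    rw [Finset.mem_compl]
    intro htA
    have := (hp c).mpr ⟨t, lateral_subset_block x c ht, (mem_lateral.mp ht).2.1, htA⟩
    rw [h] at this
    exact Bool.false_ne_true this
  obtain ⟨⟨s, hsA⟩, ⟨t, htA⟩⟩ := hs
  rw [Finset.mem_inter] at hsA htA
  have h1 : p (s x.1) = true := (hp _).mpr ⟨s, hsA.1, rfl, hsA.2⟩
  have h2 : p (t x.1) = false := by
    rw [Bool.eq_false_iff, ne_eq, hp]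
    rintro ⟨s', hs', hst, hs'A⟩
    exact Finset.mem_compl.mp htA.2 (subblock_mem_iff hx hs' htA.1 hst hs'A)
  have key : ∀ (p : Fin 3 → Bool) (i j : Fin 3), p i = true → p j = false →
      ∃ c, (p c = true ∧ p (c + 1) = false ∧ p (c + 2) = false) ∨
        (p c = false ∧ p (c + 1) = true ∧ p (c + 2) = true) := by
    intro p i j
    have hij : i = j ∨ i = j + 1 ∨ i = j + 2 := by revert i j; decide
    have e1 : j + 1 + 1 = j + 2 := by rw [add_assoc]; rfl
    have e2 : j + 1 + 2 = j := by rw [add_assoc]; exact add_zero j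
    have e3 : j + 2 + 1 = j := by rw [add_assoc]; exact add_zero j
    have e4 : j + 2 + 2 = j + 1 := by rw [add_assoc]; rfl
    intro hi hj
    rcases hij with rfl | rfl | rfl
    · rw [hi] at hj
      exact absurd hj (by decide)
    · cases h : p (j + 2)
      · exact ⟨j + 1, Or.inl ⟨hi, by rwa [e1], by rwa [e2]⟩⟩
      · exact ⟨j, Or.inr ⟨hj, hi, h⟩⟩
    · cases h : p (j + 1)
      · exact ⟨j + 2, Or.inl ⟨hi, by rwa [e3], by rwa [e4]⟩⟩
      · exact ⟨j, Or.inr ⟨hj, h, hi⟩⟩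
  obtain ⟨c, h | h⟩ := key p _ _ h1 h2
  · exact ⟨c, Or.inl ⟨hpos h.1, hneg h.2.1, hneg h.2.2⟩⟩
  · exact ⟨c, Or.inr ⟨hneg h.1, hpos h.2.1, hpos h.2.2⟩⟩

lemma exists_pairProj_mem_recon_inter {A : Finset (Site L)} {x : Hole L} (hs : Splits A x)
    (hx : ∀ y : Hole L, x.1 < y.1 → ¬ Splits A y) :
    ∃ e : Equiv.Perm (Fin 4), pairProj x (e 0) (e 1) ∈ recon A ∩ recon Aᶜ ∧
      pairProj x (e 2) (e 3) ∈ recon A ∩ recon Aᶜ := by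
  obtain ⟨c, h⟩ := exists_separated_lateral hs hx
  refine ⟨pairing c, ?_⟩
  have hne01 : pairing c 0 ≠ pairing c 1 :=
    (pairing c).injective.ne (by decide)
  have hne23 : pairing c 2 ≠ pairing c 3 :=
    (pairing c).injective.ne (by decide)
  rcases h with ⟨h₀, h₁, h₂⟩ | ⟨h₀, h₁, h₂⟩
  · exact ⟨pairProj_mem_recon_inter h₀ h₁ h₂ hne01 (pairing_pattern_zero c),
      pairProj_mem_recon_inter h₀ h₁ h₂ hne23 (pairing_pattern_one c)⟩
  · rw [Set.inter_comm]
    have key {t : ZMod 2} {b b' : Fin 4} (hne : b ≠ b')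
        (hb : ∀ a, a = b ∨ a = b' ↔ pattern a c = t) : pairProj x b b' ∈ recon Aᶜ ∩ recon A := by
      have := pairProj_mem_recon_inter (A := Aᶜ) h₀ (by rwa [compl_compl]) (by rwa [compl_compl])
        hne hb
      rwa [compl_compl] at this
    exact ⟨key hne01 (pairing_pattern_zero c), key hne23 (pairing_pattern_one c)⟩

end SierpinskiCode

theorem mainTheorem3 (L : ℕ) (A : Finset (Site L)) (hA : A.Nonempty) (hA' : Aᶜ.Nonempty) :
    codeCenter (recon A) = recon A ∩ recon Aᶜ ∧
    codeCenter (recon A) ≠ {X | ∃ z : ℂ, X = z • codeProj L} ∧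
    bulkCenter (bulkRecon A) ≠ {X | ∃ z : ℂ, X = z • (1 : BulkOp L)} ∧
    ∃ x : Hole L, Splits A x ∧ (∀ y : Hole L, x.1 < y.1 → ¬ Splits A y) ∧
      ∃ e : Equiv.Perm (Fin 4),
        pairProj x (e 0) (e 1) ∈ recon A ∩ recon Aᶜ ∧
        pairProj x (e 2) (e 3) ∈ recon A ∩ recon Aᶜ := by
  obtain ⟨x, hs, hx⟩ := exists_deepest_split hA hA'
  obtain ⟨e, he, he'⟩ := exists_pairProj_mem_recon_inter hs hx
  have hne : e 0 ≠ e 1 := e.injective.ne (by decide)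
  have hcenter : pairProj x (e 0) (e 1) ∈ codeCenter (recon A) :=
    (codeCenter_recon A).symm ▸ he
  refine ⟨codeCenter_recon A, fun h => ?_, fun h => ?_, x, hs, hx, e, he, he'⟩
  · rw [h] at hcenter
    obtain ⟨z, hz⟩ := hcenter
    exact pairProj_ne_smul_codeProj x hne z hz
  · have hbulk := encoding_conj_mem_bulkCenter hcenter
    rw [h, encoding_conj_pairProj x hne] at hbulk
    obtain ⟨z, hz⟩ := hbulk
    exact pairIndicator_ne_smul_one x _ _ z hz
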